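/- **Theorem 8 (Obtaining the TI canonical form).** *Setting.* Let $\psi=\sum_{s_1,\dots,s_N=1}^d\psi_{s_1\cdots s_N}|s_1\cdots s_N\rangle\in(\mathbb C^d)^{\otimes N}$ be a unit vector that is invariant under the cyclic translation of the $N$ sites. Let $D,L_0$ be natural numbers with $N\ge 2L_0+D^4$. - $D\times D$ matrices $A_1,\dots,A_d$ form a *translationally invariant (TI) $D$-MPS representation* of the state $\psi$ if $\psi=c\sum_{s_1,\dots,s_N}\operatorname{tr}(A_{s_1}\cdots A_{s_N})|s_1\cdots s_N\rangle$ for some $c\in\mathbb C\setminus\{0\}$. They satisfy condition C1 with the number $L_0$ if the map $X\mapsto\sum_{s_1,\dots,s_{L_0}}\operatorname{tr}(XA_{s_1}\cdots A_{s_{L_0}})|s_1\cdots s_{L_0}\rangle$ is injective on $D\times D$ matrices. - An *OBC canonical form* of $\psi$ consists of $D_m\times D_{m+1}$ matrices $A^{[m]}_i$ ($1\le m\le N$, $1\le i\le d$, $D_1=D_{N+1}=1$) with $\psi=\sum A^{[1]}_{s_1}\cdots A^{[N]}_{s_N}|s_1\cdots s_N\rangle$ such that $\sum_iA^{[m]}_iA^{[m]\dagger}_i=\mathbb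 1$ and $\sum_iA^{[m]\dagger}_i\Lambda^{[m-1]}A^{[m]}_i=\Lambda^{[m]}$ for $1\le m\le N$, where each $\Lambda^{[m]}$ ($0\le m\le N$) is a diagonal $D_{m+1}\times D_{m+1}$ matrix with positive diagonal entries and trace $1$. It is called *unique* if the Schmidt decompositions of $\psi$ are non-degenerate, that is, if for every $m$ the non-zero eigenvalues of the reduced density operator of the first $m$ sites are simple (it is then unique up to permutations and phases of the basis vectors on the bonds). - $D\times D$ matrices $A_i$ are *in TI canonical form* if, for some division of the basis vectors into non-empty blocks, $A_i=\bigoplus_j\lambda_jA_i^j$ with $0<\lambda_j\le1$, $\max_j\lambda_j=1$, and, for each $j$: $\sum_iA_i^jA_i^{j\dagger}=\mathbb 1$; $\sum_iA_i^{j\dagger}\Lambda^jA_i^j=\Lambda^j$ for some diagonal $\Lambda^j$ with positive diagonal entries; and the only fixed points of $X\mapsto\sum_iA^j_iXA^{j\dagger}_i$ are the multiples of $\mathbb 1$. *Assumptions.* The OBC canonical form of $\psi$ is unique, the reduced density operator of each block of successive sites has rank at most $D^2$, and $\psi$ has a TI $D$-MPS representation that satisfies C1 with the number $L_0$. Let $A^{[m]}_i$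 be the matrices of an OBC canonical form of $\psi$. *Claim.* The matrices $A^{[j]}_i$ with $L_0+1\le j\le L_0+D^4$ are all $D^2\times D^2$. Consider the following system (S), independent of $N$, of quadratic equations in the unknown $D^2\times D^2$ matrices $Y_j,Z_{j+1}$ ($L_0+1\le j\le L_0+D^4$) and $D\times D$ matrices $B_i$ ($1\le i\le d$): $$Y_jA^{[j]}_iZ_{j+1}=B_i\otimes\mathbb 1\ \ (L_0+1\le j\le L_0+D^4,\ 1\le i\le d),\qquad Y_jZ_j=\mathbb 1\ \ (L_0+2\le j\le L_0+D^4),\qquad \sum_iB_iB_i^\dagger=\mathbb 1 .$$ 1. The system (S) has a solution. 2. If $(Y,Z,B)$ is any solution of (S), then the $B_i$ form a TI $D$-MPS representation of the state $\psi$, and there is a unitary $U$ such that the matrices $UB_iU^\dagger$ are in TI canonical form. Moreover, whenever $D\times D$ matrices $A_i$ in TI canonical form are a representation of $\psi$, there are a unitary $U$ and a complex number $\zeta$ with $|\zeta|=1$ such that $A_i=\zeta\,UB_iU^\dagger$ for all $i$. -/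

import Mathlib

open scoped Kronecker Matrix

namespace MPS

/-- A (not necessarily normalized) vector of `(ℂ^d)^{⊗N}`, given by its coefficients in the product
basis `|s₁ ⋯ s_N⟩`. -/
abbrev Vec (d N : ℕ) : Type := (Fin N → Fin d) → ℂ

/-- Unit vectors. -/
def IsNormalized {d N : ℕ} (ψ : Vec d N) : Prop := ∑ s, ‖ψ s‖ ^ 2 = 1

/-- Invariance under the cyclic translation of the ring of `N` sites. -/
def IsTranslationInvariant {d N : ℕ} (ψ : Vec d N) : Prop :=
  ∀ s : Fin N → Fin d, ψ (s ∘ finRotate N) = ψ s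

/-! ### Reduced density operators -/

/-- The configuration that is `s` on the sites of `S` and `r` on the other sites. -/
def glue {d N : ℕ} (S : Finset (Fin N)) (s : {k // k ∈ S} → Fin d) (r : {k // k ∉ S} → Fin d) :
    Fin N → Fin d :=
  fun k => if h : k ∈ S then s ⟨k, h⟩ else r ⟨k, h⟩

/-- The reduced density operator of `|ψ⟩⟨ψ|` on the sites of `S`: the sites outside `S` are traced
out. -/
def reducedDensity {d N : ℕ} (ψ : Vec d N) (S : Finset (Fin N)) :
    Matrix ({k // k ∈ S} → Fin d) ({k // k ∈ S} → Fin d) ℂ :=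
  Matrix.of fun s t => ∑ r : {k // k ∉ S} → Fin d, ψ (glue S s r) * star (ψ (glue S t r))

/-- The reduced density operator of every block `a, a+1, …, b` of successive spins has rank at most
`R`. -/
def ReducedRanksLE {d N : ℕ} (ψ : Vec d N) (R : ℕ) : Prop :=
  ∀ a b : Fin N, (reducedDensity ψ (Finset.Icc a b)).rank ≤ R

/-- No degeneracy in the Schmidt decompositions of `ψ`: for each `m`, each non-zero eigenvalue of
the reduced density operator of the first `m` spins is simple. This is what it means that the OBC
canonical form is unique (up to permutations and phases of the basis vectors on the bonds). -/
def HasUniqueOBCCanonicalForm {d N : ℕ} (ψ : Vec d N) : Prop :=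
  ∀ m ≤ N, ∀ μ : ℂ, μ ≠ 0 →
    Module.finrank ℂ (Module.End.eigenspace
      (Matrix.toLin' (reducedDensity ψ (Finset.univ.filter fun k : Fin N => k.val < m))) μ) ≤ 1

/-! ### Open boundary conditions -/

/-- Matrices of a matrix product state with open boundary conditions on `N` sites. Sites are
numbered from `0`; `dim m` is the dimension of the bond to the right of the first `m` sites, so
that `mat m i` is the matrix of the site with number `m + 1` in the usual numbering. -/
structure OBCForm (d N : ℕ) where
  dim : Fin (N + 1) → ℕ
  dim_zero : dim 0 = 1
  dim_last : dim (Fin.last N) = 1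
  mat : (m : Fin N) → Fin d → Matrix (Fin (dim m.castSucc)) (Fin (dim m.succ)) ℂ

/-- The product of the matrices of the first `m` sites in the configuration `s`. -/
def OBCForm.partialProd {d N : ℕ} (F : OBCForm d N) (s : Fin N → Fin d) (m : Fin (N + 1)) :
    Matrix (Fin (F.dim 0)) (Fin (F.dim m)) ℂ :=
  Fin.induction (motive := fun m => Matrix (Fin (F.dim 0)) (Fin (F.dim m)) ℂ)
    1 (fun m P => P * F.mat m (s m)) m

/-- The vector with the coefficients `A^{[1]}_{s₁} ⋯ A^{[N]}_{s_N}` (these are `1 × 1` matrices). -/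
def OBCForm.toVec {d N : ℕ} (F : OBCForm d N) : Vec d N :=
  fun s => F.partialProd s (Fin.last N) (Fin.cast F.dim_zero.symm 0) (Fin.cast F.dim_last.symm 0)

/-- The gauge conditions of the OBC canonical form. `Λ m` is the diagonal of the matrix on the bond
to the right of the first `m` sites; it is automatically `1` on the two outer bonds, which have
dimension one. -/
def OBCForm.IsCanonical {d N : ℕ} (F : OBCForm d N) : Prop :=
  (∀ m : Fin N, ∑ i, F.mat m i * (F.mat m i)ᴴ = 1) ∧
  ∃ Λ : (m : Fin (N + 1)) → Fin (F.dim m) → ℝ,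
    (∀ m : Fin N, ∑ i, (F.mat m i)ᴴ * Matrix.diagonal (fun α => (Λ m.castSucc α : ℂ)) * F.mat m i =
      Matrix.diagonal (fun α => (Λ m.succ α : ℂ))) ∧
    (∀ m α, 0 < Λ m α) ∧
    (∀ m, ∑ α, Λ m α = 1)

/-- The matrices of `D ^ 4` consecutive sites, starting after the first `L₀` sites, exist and are
all `D ^ 2 × D ^ 2`. -/
def OBCForm.HasWindow {d N : ℕ} (F : OBCForm d N) (D L₀ : ℕ) : Prop :=
  L₀ + D ^ 4 ≤ N ∧ ∀ m : Fin (N + 1), L₀ ≤ m.val → m.val ≤ L₀ + D ^ 4 → F.dim m = D ^ 2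

/-- The matrices `A^{[L₀ + 1]}_i, …, A^{[L₀ + D ^ 4]}_i`. -/
def OBCForm.window {d N : ℕ} (F : OBCForm d N) {D L₀ : ℕ} (h : F.HasWindow D L₀)
    (k : Fin (D ^ 4)) (i : Fin d) : Matrix (Fin (D ^ 2)) (Fin (D ^ 2)) ℂ :=
  have hk : L₀ + k.val < N := lt_of_lt_of_le (Nat.add_lt_add_left k.isLt L₀) h.1
  (F.mat ⟨L₀ + k.val, hk⟩ i).submatrix
    (Fin.cast (h.2 (Fin.castSucc ⟨L₀ + k.val, hk⟩) (Nat.le_add_right _ _)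
      (Nat.add_le_add_left k.isLt.le L₀)).symm)
    (Fin.cast (h.2 (Fin.succ ⟨L₀ + k.val, hk⟩) (Nat.le_succ_of_le (Nat.le_add_right _ _))
      (Nat.add_le_add_left k.isLt L₀)).symm)

/-! ### Translationally invariant representations -/

/-- The product `A_{s₁} ⋯ A_{s_L}`. -/
def word {d D L : ℕ} (A : Fin d → Matrix (Fin D) (Fin D) ℂ) (s : Fin L → Fin d) :
    Matrix (Fin D) (Fin D) ℂ :=
  (List.ofFn fun k => A (s k)).prod

/-- The vector `∑ tr (A_{s₁} ⋯ A_{s_N}) |s₁ ⋯ s_N⟩`. -/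
def tiVec {d D : ℕ} (N : ℕ) (A : Fin d → Matrix (Fin D) (Fin D) ℂ) : Vec d N :=
  fun s => (word A s).trace

/-- The site-independent matrices `A` form a TI matrix product representation of the state `ψ`.
As vectors given by matrix products are not normalized, a state is represented up to a non-zero
scalar. -/
def Represents {d D N : ℕ} (A : Fin d → Matrix (Fin D) (Fin D) ℂ) (ψ : Vec d N) : Prop :=
  ∃ c : ℂ, c ≠ 0 ∧ ψ = c • tiVec N A

/-- The map `Γ_L : X ↦ ∑ tr (X A_{s₁} ⋯ A_{s_L}) |s₁ ⋯ s_L⟩`. -/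
def Gam {d D : ℕ} (A : Fin d → Matrix (Fin D) (Fin D) ℂ) (L : ℕ) (X : Matrix (Fin D) (Fin D) ℂ) :
    Vec d L :=
  fun s => (X * word A s).trace

/-- Condition C1 with the number `L₀`. -/
def ConditionC1 {d D : ℕ} (A : Fin d → Matrix (Fin D) (Fin D) ℂ) (L₀ : ℕ) : Prop :=
  Function.Injective (Gam A L₀)

/-- The conditions on one block of the TI canonical form. -/
def IsCanonicalBlock {d n : ℕ} (C : Fin d → Matrix (Fin n) (Fin n) ℂ) : Prop :=
  (∑ i, C i * (C i)ᴴ = 1) ∧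
  (∃ Λ : Fin n → ℝ, (∀ α, 0 < Λ α) ∧
    ∑ i, (C i)ᴴ * Matrix.diagonal (fun α => (Λ α : ℂ)) * C i =
      Matrix.diagonal (fun α => (Λ α : ℂ))) ∧
  (∀ X : Matrix (Fin n) (Fin n) ℂ, ∑ i, C i * X * (C i)ᴴ = X → ∃ c : ℂ, X = c • 1)

/-- The TI canonical form: `A` is block diagonal (`e` says which basis vectors form the blocks) with
blocks `w_j • C^j`, where `1 ≥ w_j > 0` and each `C^j` satisfies the conditions above. The free
common factor is fixed in the usual way: the map `X ↦ ∑ A_i X A_i†` has spectral radius one, that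
is, the largest weight is one. -/
def IsTICanonical {d D : ℕ} (A : Fin d → Matrix (Fin D) (Fin D) ℂ) : Prop :=
  ∃ (b : ℕ) (n : Fin b → ℕ) (e : (Σ j, Fin (n j)) ≃ Fin D) (w : Fin b → ℝ)
    (C : (j : Fin b) → Fin d → Matrix (Fin (n j)) (Fin (n j)) ℂ),
    (∀ j, 0 < n j) ∧ (∀ j, 0 < w j ∧ w j ≤ 1) ∧ (∃ j, w j = 1) ∧
    (∀ i, A i = Matrix.reindex e e (Matrix.blockDiagonal' fun j => (w j : ℂ) • C j i)) ∧
    ∀ j, IsCanonicalBlock (C j)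

/-! ### The system of quadratic equations -/

/-- The system (S) for given `D ^ 2 × D ^ 2` matrices `A k i` (`k` numbers the sites
`j = L₀ + 1 + k` of the window). The unknowns are `Y k = Y_j`, `Z k = Z_{j + 1}` and `B i`; rows or
columns that belong to `B i ⊗ 1` are indexed by pairs. -/
def SolvesS {d D : ℕ} (A : Fin (D ^ 4) → Fin d → Matrix (Fin (D ^ 2)) (Fin (D ^ 2)) ℂ)
    (Y : Fin (D ^ 4) → Matrix (Fin D × Fin D) (Fin (D ^ 2)) ℂ)
    (Z : Fin (D ^ 4) → Matrix (Fin (D ^ 2)) (Fin D × Fin D) ℂ)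
    (B : Fin d → Matrix (Fin D) (Fin D) ℂ) : Prop :=
  (∀ k i, B i ⊗ₖ (1 : Matrix (Fin D) (Fin D) ℂ) = Y k * A k i * Z k) ∧
  (∀ k l : Fin (D ^ 4), l.val = k.val + 1 → Y l * Z k = 1) ∧
  ∑ i, B i * (B i)ᴴ = 1

end MPS

/-! A state with a representation satisfying C1 has one whose transfer map `X ↦ ∑ A_i X A_i†` is
unital. Since words of length `L₀` span, the `L₀`-th power of this map sends non-zero positive
semidefinite matrices to positive definite ones. A Perron–Frobenius argument gives a positive
definite eigenvector `Y * Yᴴ`, and conjugation by `Y` with a rescaling makes the map unital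
(`SpansAt.exists_similar_unital`).

Cut open, the ring becomes a chain with bond space `ℂ^D ⊗ ℂ^D` and site matrices `A_i ⊗ 1`. It is
minimal at each bond with at least `L₀` sites on both sides; the OBC canonical form is minimal at
every bond. Two minimal chains with the same coefficients differ by invertible gauges on the bonds
(`Chain.exists_isGauge`, `Chain.IsGauge.mat_mul`). So the bonds of the window have dimension `D ^
2`, and the gauges and their inverses solve (S).

Conversely, after a change of gauge, a solution becomes a sequence of `D ^ 4 + 1` matrices with
`(B_i ⊗ 1) P_{k+1} = P_k (A_i ⊗ 1)`. Unitality makes it an orbit: `T P_{k+1} = P_k` for the mixed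
transfer map `T`. The orbit is as long as the dimension of the matrix space, so by Cayley–Hamilton
its span is `T`-invariant and contains an eigenvector of `T`; this intertwines `A ⊗ 1` and `B ⊗ 1`
up to a scalar, independently of the site (`SpansAt.exists_similar_of_chain`). A slice of it is an
invertible `R` with `B_i = μ R A_i R⁻¹`.

Similarity between unital families is unitary up to a phase (`SpansAt.exists_unitary_of_similar`),
and diagonalizing the dual fixed point gives the canonical form. A competing canonical family has a
minimal chain too, by comparison of bond dimensions; hence it has one block, is unital, and the same
intertwiner argument applies. -/

namespace MPS

open scoped ComplexOrder

/-! ### Quadratic forms and positive semidefinite matrices -/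

section Positivity

variable {n : Type*} [Fintype n]

/-- The real part of the quadratic form of a matrix. -/
noncomputable def quadForm (M : Matrix n n ℂ) (v : n → ℂ) : ℝ := (star v ⬝ᵥ M *ᵥ v).re

lemma coe_quadForm {M : Matrix n n ℂ} (hM : M.IsHermitian) (v : n → ℂ) :
    ((quadForm M v : ℝ) : ℂ) = star v ⬝ᵥ M *ᵥ v := by
  apply Complex.ext
  · simp [quadForm]
  · have := hM.im_star_dotProduct_mulVec_self v
    simpa using this.symm

lemma posSemidef_iff_quadForm {M : Matrix n n ℂ} :
    M.PosSemidef ↔ M.IsHermitian ∧ ∀ v, 0 ≤ quadForm M v := by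
  constructor
  · intro h
    exact ⟨h.1, fun v => h.re_dotProduct_nonneg v⟩
  · rintro ⟨h1, h2⟩
    refine .of_dotProduct_mulVec_nonneg h1 fun v => ?_
    rw [← coe_quadForm h1]
    exact_mod_cast h2 v

lemma quadForm_pos {M : Matrix n n ℂ} (hM : M.PosDef) {v : n → ℂ} (hv : v ≠ 0) :
    0 < quadForm M v := hM.re_dotProduct_pos hv

lemma quadForm_sub (M M' : Matrix n n ℂ) (v : n → ℂ) :
    quadForm (M - M') v = quadForm M v - quadForm M' v := by
  simp [quadForm, Matrix.sub_mulVec]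

lemma quadForm_real_smul (t : ℝ) (M : Matrix n n ℂ) (v : n → ℂ) :
    quadForm ((t : ℂ) • M) v = t * quadForm M v := by
  simp [quadForm, Matrix.smul_mulVec]

lemma quadForm_smul_vec (t : ℂ) (M : Matrix n n ℂ) (v : n → ℂ) :
    quadForm M (t • v) = ‖t‖ ^ 2 * quadForm M v := by
  have : star (t • v) ⬝ᵥ M *ᵥ (t • v) = ((‖t‖ ^ 2 : ℝ) : ℂ) * (star v ⬝ᵥ M *ᵥ v) := by
    simp only [star_smul, Matrix.mulVec_smul, smul_dotProduct, dotProduct_smul, smul_eq_mul]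
    rw [← mul_assoc]
    congr 1
    push_cast
    rw [← Complex.mul_conj']
    simp
  rw [quadForm, this, Complex.re_ofReal_mul, quadForm]

lemma continuous_quadForm (M : Matrix n n ℂ) : Continuous (quadForm M) := by
  unfold quadForm
  fun_prop

lemma isHermitian_real_smul {m : Type*} (t : ℝ) {M : Matrix m m ℂ} (hM : M.IsHermitian) :
    ((t : ℂ) • M).IsHermitian := by
  simp [Matrix.IsHermitian, Matrix.conjTranspose_smul, hM.eq]

lemma isCompact_unitSphere (ι : Type*) [Fintype ι] :
    IsCompact {v : ι → ℂ | ∑ i, ‖v i‖ ^ 2 = 1} := by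
  refine (isCompact_univ_pi (fun _ : ι => isCompact_closedBall (0 : ℂ) 1)).of_isClosed_subset
    (isClosed_eq (by fun_prop) continuous_const) ?_
  intro v hv i _
  have h1 : ‖v i‖ ^ 2 ≤ ∑ i, ‖v i‖ ^ 2 :=
    Finset.single_le_sum (f := fun i => ‖v i‖ ^ 2) (fun i _ => by positivity) (Finset.mem_univ i)
  rw [hv] at h1
  simpa using h1

lemma exists_smul_mem_unitSphere {ι : Type*} [Fintype ι] {v : ι → ℂ} (hv : v ≠ 0) :
    ∃ t : ℝ, 0 < t ∧ ∑ i, ‖((t : ℂ) • v) i‖ ^ 2 = 1 := by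
  have hpos : 0 < ∑ i, ‖v i‖ ^ 2 := by
    obtain ⟨i, hi⟩ := Function.ne_iff.1 hv
    refine Finset.sum_pos' (fun i _ => by positivity) ⟨i, Finset.mem_univ i, ?_⟩
    have : 0 < ‖v i‖ := norm_pos_iff.2 hi
    positivity
  refine ⟨(√(∑ i, ‖v i‖ ^ 2))⁻¹, by positivity, ?_⟩
  simp only [Pi.smul_apply, smul_eq_mul, norm_mul, mul_pow, ← Finset.mul_sum]
  rw [Complex.norm_real, Real.norm_of_nonneg (by positivity), inv_pow, Real.sq_sqrt hpos.le,
    inv_mul_cancel₀ hpos.ne']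

/-- The largest multiple of a positive definite matrix that can be subtracted from a Hermitian
matrix with a positive semidefinite difference; the difference is singular. -/
lemma exists_smul_sub_posSemidef [Nonempty n] {H M : Matrix n n ℂ} (hH : H.IsHermitian)
    (hM : M.PosDef) :
    ∃ t : ℝ, (H - (t : ℂ) • M).PosSemidef ∧ ∃ v, v ≠ 0 ∧ (H - (t : ℂ) • M) *ᵥ v = 0 := by
  classical
  have hne : ∀ v ∈ {v : n → ℂ | ∑ i, ‖v i‖ ^ 2 = 1}, v ≠ 0 := by
    rintro v hv rfl
    simp at hv
  -- The multiple is the minimum of the generalized Rayleigh quotient, and a minimizer spans a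
  -- kernel direction of the difference.
  obtain ⟨v₀, hv₀, hmin⟩ := (isCompact_unitSphere n).exists_isMinOn
    (f := fun v => quadForm H v / quadForm M v)
    (by
      obtain ⟨t, -, ht⟩ := exists_smul_mem_unitSphere (v := (1 : n → ℂ)) one_ne_zero
      exact ⟨_, ht⟩)
    ((continuous_quadForm H).continuousOn.div (continuous_quadForm M).continuousOn
      fun v hv => (quadForm_pos hM (hne v hv)).ne')
  set t := quadForm H v₀ / quadForm M v₀ with ht
  have hpsd : (H - (t : ℂ) • M).PosSemidef := by
    refine posSemidef_iff_quadForm.2 ⟨hH.sub (isHermitian_real_smul t hM.1), fun v => ?_⟩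
    rw [quadForm_sub, quadForm_real_smul]
    by_cases hv : v = 0
    · simp [hv, quadForm]
    obtain ⟨s, hs, hsv⟩ := exists_smul_mem_unitSphere hv
    have h1 := hmin hsv
    simp only [Set.mem_ofPred_eq] at h1
    rw [← ht, le_div_iff₀ (quadForm_pos hM (hne _ hsv)), quadForm_smul_vec, quadForm_smul_vec,
      Complex.norm_real] at h1
    have : 0 < ‖s‖ ^ 2 := by
      have := norm_pos_iff.2 hs.ne'
      positivity
    nlinarith
  refine ⟨t, hpsd, v₀, hne _ hv₀, ?_⟩
  rw [← hpsd.dotProduct_mulVec_zero_iff, ← coe_quadForm hpsd.1, quadForm_sub, quadForm_real_smul,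
    ht, div_mul_cancel₀ _ (quadForm_pos hM (hne _ hv₀)).ne', sub_self, Complex.ofReal_zero]

lemma posDef_of_mulVec_ne_zero {M : Matrix n n ℂ} (hM : M.PosSemidef)
    (h : ∀ v, M *ᵥ v = 0 → v = 0) : M.PosDef := by
  refine .of_dotProduct_mulVec_pos hM.1 fun v hv => ?_
  refine lt_of_le_of_ne (hM.dotProduct_mulVec_nonneg v) fun h0 => hv (h v ?_)
  exact (hM.dotProduct_mulVec_zero_iff v).1 h0.symm

lemma mulVec_eq_zero_of_posDef {M : Matrix n n ℂ} (hM : M.PosDef) {v : n → ℂ}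
    (h : M *ᵥ v = 0) : v = 0 := by
  by_contra hv
  have := quadForm_pos hM hv
  simp [quadForm, h] at this

end Positivity

/-! ### Strict positivity of transfer maps -/

section Transfer

variable {d D : ℕ}

/-- The completely positive map `X ↦ ∑ A_i X A_i†`. -/
noncomputable def transfer (A : Fin d → Matrix (Fin D) (Fin D) ℂ) :
    Module.End ℂ (Matrix (Fin D) (Fin D) ℂ) where
  toFun X := ∑ i, A i * X * (A i)ᴴ
  map_add' X Y := by simp [mul_add, add_mul, Finset.sum_add_distrib]
  map_smul' c X := by simp [Finset.smul_sum]

lemma transfer_apply (A : Fin d → Matrix (Fin D) (Fin D) ℂ) (X : Matrix (Fin D) (Fin D) ℂ) :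
    transfer A X = ∑ i, A i * X * (A i)ᴴ := rfl

/-- The products of `L` of the matrices span the space of all matrices. -/
def SpansAt (A : Fin d → Matrix (Fin D) (Fin D) ℂ) (L : ℕ) : Prop :=
  ∀ X : Matrix (Fin D) (Fin D) ℂ,
    (∀ w : List (Fin d), w.length = L → (X * (w.map A).prod).trace = 0) → X = 0

lemma posSemidef_transfer (A : Fin d → Matrix (Fin D) (Fin D) ℂ) {X : Matrix (Fin D) (Fin D) ℂ}
    (hX : X.PosSemidef) : (transfer A X).PosSemidef :=
  Matrix.posSemidef_sum _ fun i _ => hX.mul_mul_conjTranspose_same (A i)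

lemma posSemidef_transfer_pow (A : Fin d → Matrix (Fin D) (Fin D) ℂ) (L : ℕ)
    {X : Matrix (Fin D) (Fin D) ℂ} (hX : X.PosSemidef) : ((transfer A ^ L) X).PosSemidef := by
  induction L with
  | zero => simpa
  | succ L ih =>
    rw [pow_succ', Module.End.mul_apply]
    exact posSemidef_transfer A ih

lemma conjTranspose_transfer (A : Fin d → Matrix (Fin D) (Fin D) ℂ)
    (X : Matrix (Fin D) (Fin D) ℂ) : (transfer A X)ᴴ = transfer A Xᴴ := by
  simp [transfer_apply, Matrix.conjTranspose_sum, Matrix.conjTranspose_mul, mul_assoc]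

/-- The form of `transfer A X` at `v` is the sum of the forms of `X` at the vectors `A_i† v`;
non-negative terms with sum zero all vanish. -/
lemma mulVec_eq_zero_of_transfer (A : Fin d → Matrix (Fin D) (Fin D) ℂ)
    {X : Matrix (Fin D) (Fin D) ℂ} (hX : X.PosSemidef) {v : Fin D → ℂ}
    (h : transfer A X *ᵥ v = 0) (i : Fin d) : X *ᵥ ((A i)ᴴ *ᵥ v) = 0 := by
  rw [← (posSemidef_transfer A hX).dotProduct_mulVec_zero_iff, transfer_apply, Matrix.sum_mulVec,
    dotProduct_sum] at h
  have h1 : ∀ j ∈ Finset.univ, 0 ≤ star v ⬝ᵥ (A j * X * (A j)ᴴ) *ᵥ v := fun j _ =>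
    (hX.mul_mul_conjTranspose_same (A j)).dotProduct_mulVec_nonneg v
  have h2 := (Finset.sum_eq_zero_iff_of_nonneg h1).1 h i (Finset.mem_univ i)
  rw [← hX.dotProduct_mulVec_zero_iff, ← h2, Matrix.star_mulVec, Matrix.conjTranspose_conjTranspose,
    ← Matrix.dotProduct_mulVec, Matrix.mulVec_mulVec, Matrix.mulVec_mulVec, mul_assoc]

lemma mulVec_eq_zero_of_transfer_pow (A : Fin d → Matrix (Fin D) (Fin D) ℂ) (L : ℕ)
    {X : Matrix (Fin D) (Fin D) ℂ} (hX : X.PosSemidef) :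
    ∀ {v : Fin D → ℂ}, (transfer A ^ L) X *ᵥ v = 0 → ∀ w : List (Fin d), w.length = L →
      X *ᵥ ((w.map A).prodᴴ *ᵥ v) = 0 := by
  induction L with
  | zero =>
    intro v h w hw
    rw [List.length_eq_zero_iff.1 hw]
    simpa using h
  | succ L ih =>
    intro v h w hw
    obtain ⟨i, w, rfl⟩ := List.exists_cons_of_length_eq_add_one hw
    rw [pow_succ', Module.End.mul_apply] at h
    have := ih (mulVec_eq_zero_of_transfer A (posSemidef_transfer_pow A L hX) h i) w (by simpa using hw)
    simpa [Matrix.conjTranspose_mul, ← Matrix.mulVec_mulVec] using this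

/-- If the products of `L` of the matrices span, the `L`-th power of the transfer map is strictly
positive. -/
lemma SpansAt.posDef_transfer_pow {A : Fin d → Matrix (Fin D) (Fin D) ℂ} {L : ℕ}
    (hA : SpansAt A L) {X : Matrix (Fin D) (Fin D) ℂ} (hX : X.PosSemidef) (hX0 : X ≠ 0) :
    ((transfer A ^ L) X).PosDef := by
  refine posDef_of_mulVec_ne_zero (posSemidef_transfer_pow A L hX) fun v hv => ?_
  by_contra hv0
  obtain ⟨b, hb⟩ := Function.ne_iff.1 hv0
  apply hX0
  ext k a
  -- The trace of this rank-one matrix against a word `W` is the conjugate of the `k`-th entry of `X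
  -- W† v`.
  have h := hA (Matrix.vecMulVec (star (X k)) (star v)) fun w hw => by
    have h1 := congrFun (mulVec_eq_zero_of_transfer_pow A L hX hv w hw) k
    rw [Matrix.vecMulVec_mul, Matrix.trace_vecMulVec]
    have h2 := congrArg star h1
    rw [Pi.zero_apply, star_zero, Matrix.mulVec, ← Matrix.star_dotProduct_star,
      Matrix.star_mulVec, Matrix.conjTranspose_conjTranspose] at h2
    rw [← h2]
    exact dotProduct_comm _ _
  have h3 := congrFun (congrFun h a) b
  simp only [Matrix.vecMulVec_apply, Pi.star_apply, Matrix.zero_apply, mul_eq_zero,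
    star_eq_zero] at h3
  simpa using h3.resolve_right hb

end Transfer

/-! ### Perron–Frobenius theory and unitary equivalence -/

section PerronFrobenius

variable {d D : ℕ} {A : Fin d → Matrix (Fin D) (Fin D) ℂ} {L : ℕ}

lemma SpansAt.conjTranspose (hA : SpansAt A L) : SpansAt (fun i => (A i)ᴴ) L := by
  intro X hX
  rw [← Matrix.conjTranspose_eq_zero]
  refine hA _ fun w hw => ?_
  have h := congrArg star (hX w.reverse (by simpa using hw))
  rw [star_zero, ← Matrix.trace_conjTranspose, Matrix.conjTranspose_mul,
    Matrix.conjTranspose_list_prod, Matrix.trace_mul_comm] at h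
  simpa [List.map_map, Function.comp_def] using h

lemma transfer_pow_apply_eq_smul {X : Matrix (Fin D) (Fin D) ℂ} {r : ℂ}
    (h : transfer A X = r • X) (L : ℕ) : (transfer A ^ L) X = r ^ L • X := by
  induction L with
  | zero => simp
  | succ L ih => rw [pow_succ', Module.End.mul_apply, ih, map_smul, h, smul_smul, pow_succ]

lemma quadForm_eq_zero_of_mulVec {M : Matrix (Fin D) (Fin D) ℂ} {v : Fin D → ℂ}
    (h : M *ᵥ v = 0) : quadForm M v = 0 := by simp [quadForm, h]

/-- This is the domain of the Collatz–Wielandt problem: maximize `r` subject to `r X ≤ transfer A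
X`. Writing `X` as `y y†` builds in positivity and turns trace one into a sphere condition. Taking
traces in the inequality bounds `r`. -/
lemma isCompact_subinvariant (A : Fin d → Matrix (Fin D) (Fin D) ℂ) :
    IsCompact {p : ℝ × (Fin D × Fin D → ℂ) | 0 ≤ p.1 ∧ (∑ a, ‖p.2 a‖ ^ 2 = 1) ∧
      (transfer A ((Matrix.of fun a b => p.2 (a, b)) * (Matrix.of fun a b => p.2 (a, b))ᴴ) -
        (p.1 : ℂ) • ((Matrix.of fun a b => p.2 (a, b)) *
          (Matrix.of fun a b => p.2 (a, b))ᴴ)).PosSemidef} := by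
  set X : (Fin D × Fin D → ℂ) → Matrix (Fin D) (Fin D) ℂ :=
    fun y => (Matrix.of fun a b => y (a, b)) * (Matrix.of fun a b => y (a, b))ᴴ with hXdef
  have hXc : Continuous X := by
    have : Continuous fun y : Fin D × Fin D → ℂ => (Matrix.of fun a b => y (a, b)) :=
      continuous_matrix fun a b => by fun_prop
    exact this.matrix_mul this.matrix_conjTranspose
  have hTc : Continuous fun y => transfer A (X y) := by
    simp only [transfer_apply]
    exact continuous_finsetSum _ fun i _ =>
      (continuous_const.matrix_mul hXc).matrix_mul continuous_const
  have hXh : ∀ y, (X y).PosSemidef := fun y => Matrix.posSemidef_self_mul_conjTranspose _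
  have htr : ∀ y, (X y).trace = ((∑ a, ‖y a‖ ^ 2 : ℝ) : ℂ) := by
    intro y
    rw [hXdef, Fintype.sum_prod_type]
    simp [Matrix.trace, Matrix.mul_apply, Complex.mul_conj']
  obtain ⟨R, hR⟩ := (isCompact_unitSphere (Fin D × Fin D)).bddAbove_image
    (f := fun y => (transfer A (X y)).trace.re)
    (Complex.continuous_re.comp hTc.matrix_trace).continuousOn
  refine ((isCompact_Icc (a := (0 : ℝ)) (b := R)).prod
    (isCompact_unitSphere (Fin D × Fin D))).of_isClosed_subset ?_ ?_
  · have : {p : ℝ × (Fin D × Fin D → ℂ) | 0 ≤ p.1 ∧ (∑ a, ‖p.2 a‖ ^ 2 = 1) ∧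
        (transfer A (X p.2) - (p.1 : ℂ) • X p.2).PosSemidef} =
        {p | 0 ≤ p.1} ∩ ({p | ∑ a, ‖p.2 a‖ ^ 2 = 1} ∩
          ⋂ v, {p | 0 ≤ quadForm (transfer A (X p.2) - (p.1 : ℂ) • X p.2) v}) := by
      ext p
      simp only [Set.mem_ofPred_eq, Set.mem_inter_iff, Set.mem_iInter, posSemidef_iff_quadForm]
      have : (transfer A (X p.2) - (p.1 : ℂ) • X p.2).IsHermitian :=
        (posSemidef_transfer A (hXh _)).1.sub (isHermitian_real_smul _ (hXh _).1)
      tauto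
    change IsClosed {p : ℝ × (Fin D × Fin D → ℂ) | 0 ≤ p.1 ∧ (∑ a, ‖p.2 a‖ ^ 2 = 1) ∧
        (transfer A (X p.2) - (p.1 : ℂ) • X p.2).PosSemidef}
    rw [this]
    refine (isClosed_le continuous_const continuous_fst).inter
      ((isClosed_eq (by fun_prop) continuous_const).inter
        (isClosed_iInter fun v => isClosed_le continuous_const ?_))
    refine Complex.continuous_re.comp (continuous_const.dotProduct
      (Continuous.matrix_mulVec ?_ continuous_const))
    exact (hTc.comp continuous_snd).sub
      ((Complex.continuous_ofReal.comp continuous_fst).smul (hXc.comp continuous_snd))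
  · rintro ⟨r, y⟩ ⟨h0, h1, h2⟩
    refine ⟨⟨h0, ?_⟩, h1⟩
    have h3 := hR ⟨y, h1, rfl⟩
    have h4 := h2.trace_nonneg
    have h1' : ∑ a, ‖y a‖ ^ 2 = 1 := h1
    change 0 ≤ (transfer A (X y) - (r : ℂ) • X y).trace at h4
    rw [Matrix.trace_sub, Matrix.trace_smul, htr, h1', Complex.le_def] at h4
    have h5 : 0 ≤ (transfer A (X y)).trace.re - r := by simpa using h4.1
    simp only at h3
    linarith

open scoped MatrixOrder in
lemma exists_eq_mul_conjTranspose {X : Matrix (Fin D) (Fin D) ℂ} (hX : X.PosSemidef) :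
    ∃ Y : Matrix (Fin D) (Fin D) ℂ, X = Y * Yᴴ := by
  obtain ⟨B, rfl⟩ := CStarAlgebra.nonneg_iff_eq_star_mul_self.mp hX.nonneg
  exact ⟨Bᴴ, by simp [Matrix.star_eq_conjTranspose]⟩

/-- The transfer map has a positive definite eigenvector with a positive eigenvalue. -/
theorem SpansAt.exists_posDef_eigenvector [NeZero D] (hA : SpansAt A L) (hA0 : ∃ i, A i ≠ 0) :
    ∃ r : ℝ, 0 < r ∧ ∃ X : Matrix (Fin D) (Fin D) ℂ, X.PosDef ∧
      transfer A X = (r : ℂ) • X := by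
  have hmem : ∀ (r : ℝ) (X : Matrix (Fin D) (Fin D) ℂ), 0 ≤ r → X.PosSemidef → X ≠ 0 →
      (transfer A X - (r : ℂ) • X).PosSemidef →
      ∃ y : Fin D × Fin D → ℂ, 0 ≤ r ∧ (∑ a, ‖y a‖ ^ 2 = 1) ∧
      (transfer A ((Matrix.of fun a b => y (a, b)) * (Matrix.of fun a b => y (a, b))ᴴ) -
        (r : ℂ) • ((Matrix.of fun a b => y (a, b)) *
          (Matrix.of fun a b => y (a, b))ᴴ)).PosSemidef := by
    intro r X hr hX hX0 h
    obtain ⟨Y, rfl⟩ := exists_eq_mul_conjTranspose hX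
    have hY : (fun p : Fin D × Fin D => Y p.1 p.2) ≠ 0 := by
      rintro h0
      apply hX0
      have : Y = 0 := by ext a b; exact congrFun h0 (a, b)
      simp [this]
    obtain ⟨t, ht, hty⟩ := exists_smul_mem_unitSphere hY
    refine ⟨_, hr, hty, ?_⟩
    have : (Matrix.of fun a b => ((t : ℂ) • fun p : Fin D × Fin D => Y p.1 p.2) (a, b)) =
        (t : ℂ) • Y := by ext; simp
    have h2 : ((t : ℂ) • Y) * ((t : ℂ) • Y)ᴴ = ((t ^ 2 : ℝ) : ℂ) • (Y * Yᴴ) := by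
      ext a b
      simp [Matrix.conjTranspose_smul, pow_two, mul_assoc]
    rw [this, h2, map_smul, smul_comm, ← smul_sub]
    exact h.smul (by exact_mod_cast sq_nonneg t)
  obtain ⟨⟨r, y⟩, ⟨hr0, hy, hpsd⟩, hmax⟩ := (isCompact_subinvariant A).exists_isMaxOn
    (by
      obtain ⟨y, hy⟩ := hmem 0 1 le_rfl .one one_ne_zero
        (by simpa using posSemidef_transfer A .one)
      exact ⟨(0, y), hy⟩) continuous_fst.continuousOn
  set X := (Matrix.of fun a b => y (a, b)) * (Matrix.of fun a b => y (a, b))ᴴ with hXdef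
  have hX : X.PosSemidef := Matrix.posSemidef_self_mul_conjTranspose _
  have hX0 : X ≠ 0 := by
    rw [hXdef, Ne, Matrix.self_mul_conjTranspose_eq_zero]
    intro h
    have h' : y = 0 := by
      ext ⟨a, b⟩
      exact congrFun (congrFun h a) b
    rw [h'] at hy
    simp at hy
  have heig : transfer A X = (r : ℂ) • X := by
    by_contra hne
    have hΔ := hA.posDef_transfer_pow hpsd (sub_ne_zero.2 hne)
    have hX' := hA.posDef_transfer_pow hX hX0
    set X' := (transfer A ^ L) X with hX'def
    have hcomm : (transfer A ^ L) (transfer A X - (r : ℂ) • X) =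
        transfer A X' - (r : ℂ) • X' := by
      rw [map_sub, map_smul, ← Module.End.mul_apply, ← Module.End.mul_apply,
        ← pow_succ, pow_succ']
    rw [hcomm] at hΔ
    obtain ⟨t, ht, v, hv, htv⟩ := exists_smul_sub_posSemidef hΔ.1 hX'
    have h1 := quadForm_eq_zero_of_mulVec htv
    rw [quadForm_sub, quadForm_real_smul] at h1
    have h2 := quadForm_pos hΔ hv
    have h3 := quadForm_pos hX' hv
    have ht0 : 0 < t := by
      by_contra hcon
      nlinarith
    obtain ⟨y', hy'⟩ := hmem (r + t) X' (by positivity) hX'.posSemidef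
      (by rintro h0; rw [h0] at h3; simp [quadForm] at h3)
      (by
        convert ht using 1
        push_cast
        rw [add_smul]
        abel)
    have := hmax (show ((r + t, y') : ℝ × _) ∈ _ from hy')
    simp only [Set.mem_ofPred_eq] at this
    linarith
  have hpd := hA.posDef_transfer_pow hX hX0
  rw [transfer_pow_apply_eq_smul heig] at hpd
  have hXpd : X.PosDef := by
    refine posDef_of_mulVec_ne_zero hX fun v hv => ?_
    refine mulVec_eq_zero_of_posDef hpd ?_
    rw [Matrix.smul_mulVec, hv, smul_zero]
  -- Eigenvalue zero is impossible: a positive definite `X` in the kernel of the transfer map would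
  -- force every `A_i†` to vanish.
  rcases hr0.eq_or_lt with h0 | h0
  · exfalso
    simp only at h0
    rw [← h0] at heig
    obtain ⟨i, hi⟩ := hA0
    apply hi
    rw [← Matrix.conjTranspose_eq_zero]
    refine Matrix.ext_of_mulVec_single fun k => ?_
    rw [Matrix.zero_mulVec]
    refine mulVec_eq_zero_of_posDef hXpd (mulVec_eq_zero_of_transfer A hX ?_ i)
    rw [heig, Complex.ofReal_zero, zero_smul, Matrix.zero_mulVec]
  · exact ⟨r, h0, X, hXpd, heig⟩

/-- A positive definite eigenvector of a unital strictly positive transfer map is scalar, with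
eigenvalue one. -/
lemma SpansAt.eigenvalue_eq_one [NeZero D] (hone : transfer A 1 = 1)
    {X : Matrix (Fin D) (Fin D) ℂ} (hX : X.PosDef) {r : ℝ} (hr : transfer A X = (r : ℂ) • X) :
    r = 1 := by
  -- Subtract the largest multiple of `X` from `1`, apply the map, and evaluate at a kernel vector
  -- of the difference: this gives `r ≤ 1`. Exchanging `1` and `X` gives `1 ≤ r`.
  apply le_antisymm
  · obtain ⟨t, ht, v, hv, htv⟩ := exists_smul_sub_posSemidef Matrix.isHermitian_one hX
    have h1 := quadForm_eq_zero_of_mulVec htv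
    have h2 := (posSemidef_iff_quadForm.1 (posSemidef_transfer A ht)).2 v
    rw [map_sub, map_smul, hone, hr, smul_smul, ← Complex.ofReal_mul] at h2
    rw [quadForm_sub, quadForm_real_smul] at h1 h2
    have h3 := quadForm_pos hX hv
    have h4 := quadForm_pos (Matrix.PosDef.one (n := Fin D) (R := ℂ)) hv
    have ht0 : 0 < t := by
      by_contra hcon
      nlinarith
    have : 0 < t * quadForm X v := by positivity
    nlinarith
  · obtain ⟨t, ht, v, hv, htv⟩ := exists_smul_sub_posSemidef hX.1
      (Matrix.PosDef.one (n := Fin D) (R := ℂ))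
    have h1 := quadForm_eq_zero_of_mulVec htv
    have h2 := (posSemidef_iff_quadForm.1 (posSemidef_transfer A ht)).2 v
    rw [map_sub, map_smul, hone, hr] at h2
    rw [quadForm_sub, quadForm_real_smul] at h1 h2
    rw [quadForm_real_smul] at h2
    have h3 := quadForm_pos hX hv
    nlinarith

/-- Subtracting the largest multiple of `1` leaves a singular positive semidefinite fixed point;
strict positivity makes it positive definite unless it is zero. -/
lemma SpansAt.exists_eq_smul_one_of_isHermitian [NeZero D] (hA : SpansAt A L)
    (hone : transfer A 1 = 1) {X : Matrix (Fin D) (Fin D) ℂ} (hX : X.IsHermitian)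
    (hfix : transfer A X = X) : ∃ t : ℝ, X = (t : ℂ) • 1 := by
  obtain ⟨t, ht, v, hv, htv⟩ := exists_smul_sub_posSemidef hX
    (Matrix.PosDef.one (n := Fin D) (R := ℂ))
  refine ⟨t, ?_⟩
  by_contra hne
  have h := hA.posDef_transfer_pow ht (sub_ne_zero.2 hne)
  rw [transfer_pow_apply_eq_smul (r := 1) (by simp [hfix, hone]), one_pow, one_smul] at h
  exact hv (mulVec_eq_zero_of_posDef h htv)

/-- The fixed points of a unital strictly positive transfer map are the scalars. -/
theorem SpansAt.exists_eq_smul_one [NeZero D] (hA : SpansAt A L)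
    (hone : transfer A 1 = 1) {X : Matrix (Fin D) (Fin D) ℂ}
    (hfix : transfer A X = X) : ∃ c : ℂ, X = c • 1 := by
  have hfix' : transfer A Xᴴ = Xᴴ := by rw [← conjTranspose_transfer, hfix]
  obtain ⟨t, ht⟩ := hA.exists_eq_smul_one_of_isHermitian hone (X := X + Xᴴ)
    (Matrix.isHermitian_add_transpose_self X) (by rw [map_add, hfix, hfix'])
  obtain ⟨s, hs⟩ := hA.exists_eq_smul_one_of_isHermitian hone (X := Complex.I • (X - Xᴴ))
    (by
      rw [Matrix.IsHermitian, Matrix.conjTranspose_smul, Matrix.conjTranspose_sub,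
        Matrix.conjTranspose_conjTranspose, Complex.star_def, Complex.conj_I, neg_smul,
        ← smul_neg, neg_sub])
    (by rw [map_smul, map_sub, hfix, hfix'])
  refine ⟨(2 : ℂ)⁻¹ * (t - Complex.I * s), ?_⟩
  have hs' : X - Xᴴ = (-Complex.I * s) • (1 : Matrix (Fin D) (Fin D) ℂ) := by
    rw [← smul_smul, ← hs, smul_smul, neg_mul, Complex.I_mul_I, neg_neg, one_smul]
  have h2 : (2 : ℂ) • X = ((t : ℂ) - Complex.I * s) • (1 : Matrix (Fin D) (Fin D) ℂ) := by
    rw [sub_eq_add_neg, add_smul, ← neg_mul, ← hs', ← ht, two_smul]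
    abel
  rw [← smul_smul, ← h2, smul_smul, inv_mul_cancel₀ two_ne_zero, one_smul]

lemma transfer_conj {B : Fin d → Matrix (Fin D) (Fin D) ℂ} {R S : Matrix (Fin D) (Fin D) ℂ} {μ : ℂ}
    (hSR : S * R = 1) (h : ∀ i, B i = μ • (R * A i * S)) (X : Matrix (Fin D) (Fin D) ℂ) :
    transfer B (R * X * Rᴴ) = ((‖μ‖ ^ 2 : ℝ) : ℂ) • (R * transfer A X * Rᴴ) := by
  have hRS : Rᴴ * Sᴴ = 1 := by rw [← Matrix.conjTranspose_mul, hSR, Matrix.conjTranspose_one]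
  have hμ : μ * star μ = ((‖μ‖ ^ 2 : ℝ) : ℂ) := by
    rw [Complex.star_def, Complex.mul_conj']
    push_cast
    rfl
  simp only [transfer_apply, Finset.mul_sum, Finset.sum_mul, Finset.smul_sum]
  refine Finset.sum_congr rfl fun i _ => ?_
  rw [h, Matrix.conjTranspose_smul, ← hμ]
  simp only [Matrix.smul_mul, Matrix.mul_smul, smul_smul, Matrix.conjTranspose_mul]
  rw [mul_comm]
  congr 1
  calc R * A i * S * (R * X * Rᴴ) * (Sᴴ * ((A i)ᴴ * Rᴴ))
      = R * A i * (S * R) * X * (Rᴴ * Sᴴ) * ((A i)ᴴ * Rᴴ) := by simp only [mul_assoc]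
    _ = R * (A i * X * (A i)ᴴ) * Rᴴ := by rw [hSR, hRS]; simp only [mul_assoc, mul_one]

/-- Similar families with unital transfer maps are unitarily equivalent up to a phase. -/
theorem SpansAt.exists_unitary_of_similar [NeZero D] (hA : SpansAt A L) (hone : transfer A 1 = 1)
    {B : Fin d → Matrix (Fin D) (Fin D) ℂ} (hB : transfer B 1 = 1)
    {R S : Matrix (Fin D) (Fin D) ℂ} {μ : ℂ} (hRS : R * S = 1)
    (h : ∀ i, B i = μ • (R * A i * S)) (hμ : μ ≠ 0) :
    ∃ U ∈ Matrix.unitaryGroup (Fin D) ℂ, ∃ ζ : ℂ, ‖ζ‖ = 1 ∧ ∀ i, B i = ζ • (U * A i * Uᴴ) := by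
  have hSR : S * R = 1 := mul_eq_one_comm.1 hRS
  have hSR' : Rᴴ * Sᴴ = 1 := by rw [← Matrix.conjTranspose_mul, hSR, Matrix.conjTranspose_one]
  have hpd : (S * Sᴴ).PosDef := by
    refine posDef_of_mulVec_ne_zero (Matrix.posSemidef_self_mul_conjTranspose S) fun v hv => ?_
    have : (Rᴴ * R) *ᵥ ((S * Sᴴ) *ᵥ v) = v := by
      rw [Matrix.mulVec_mulVec, mul_assoc, ← mul_assoc R, hRS, one_mul, hSR', Matrix.one_mulVec]
    rw [← this, hv, Matrix.mulVec_zero]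
  have hμ0 : (‖μ‖ ^ 2 : ℝ) ≠ 0 := by simpa using hμ
  have h1 : R * (S * Sᴴ) * Rᴴ = 1 := by
    rw [← mul_assoc, hRS, one_mul, ← Matrix.conjTranspose_mul, hRS, Matrix.conjTranspose_one]
  -- Unitality of `B`, pulled back along the similarity, makes `S * Sᴴ` a positive definite
  -- eigenvector for `A`. Its eigenvalue must be one, so `‖μ‖ = 1`, and it must be scalar, so `R` is
  -- a multiple of a unitary.
  have heig : transfer A (S * Sᴴ) = (((‖μ‖ ^ 2)⁻¹ : ℝ) : ℂ) • (S * Sᴴ) := by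
    have h2 := transfer_conj hSR h (S * Sᴴ)
    rw [h1, hB] at h2
    have h3 := congrArg (fun M => S * M * Sᴴ) h2
    simp only [mul_one, Matrix.mul_smul, Matrix.smul_mul] at h3
    conv_rhs => rw [h3]
    rw [smul_smul, ← Complex.ofReal_mul, inv_mul_cancel₀ hμ0, Complex.ofReal_one, one_smul,
      mul_assoc, mul_assoc, mul_assoc, hSR', mul_one, ← mul_assoc, hSR, one_mul]
  have hr := SpansAt.eigenvalue_eq_one hone hpd heig
  have hμ1 : ‖μ‖ = 1 := by
    rw [inv_eq_one] at hr
    exact (pow_eq_one_iff_of_nonneg (norm_nonneg μ) two_ne_zero).1 hr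
  rw [hr, Complex.ofReal_one, one_smul] at heig
  obtain ⟨t, ht⟩ := hA.exists_eq_smul_one_of_isHermitian hone hpd.1 heig
  have ht0 : 0 < t := by
    have hv : (1 : Fin D → ℂ) ≠ 0 := one_ne_zero
    have h4 := quadForm_pos hpd hv
    rw [ht, quadForm_real_smul] at h4
    have h5 := quadForm_pos (Matrix.PosDef.one (n := Fin D) (R := ℂ)) hv
    by_contra hcon
    nlinarith
  have hst : ((√t : ℝ) : ℂ) * ((√t : ℝ) : ℂ) = t := by
    rw [← Complex.ofReal_mul, Real.mul_self_sqrt ht0.le]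
  have hS : S = (t : ℂ) • Rᴴ := by
    calc S = S * (Sᴴ * Rᴴ) := by
          rw [← Matrix.conjTranspose_mul, hRS, Matrix.conjTranspose_one, mul_one]
      _ = (t : ℂ) • Rᴴ := by rw [← mul_assoc, ht, Matrix.smul_mul, one_mul]
  refine ⟨((√t : ℝ) : ℂ) • R, ?_, μ, hμ1, fun i => ?_⟩
  · rw [Matrix.mem_unitaryGroup_iff, Matrix.star_eq_conjTranspose, Matrix.conjTranspose_smul,
      Matrix.smul_mul, Matrix.mul_smul, smul_smul, Complex.star_def, Complex.conj_ofReal, hst,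
      ← Matrix.mul_smul, ← hS, hRS]
  · rw [h, hS]
    simp only [Matrix.conjTranspose_smul, Matrix.smul_mul, Matrix.mul_smul, smul_smul,
      Complex.star_def, Complex.conj_ofReal]
    rw [mul_assoc, hst]

/-- A family with a unital strictly positive transfer map becomes a canonical block after a unitary
change of basis. -/
theorem SpansAt.exists_unitary_isCanonicalBlock [NeZero D] (hA : SpansAt A L)
    (hone : transfer A 1 = 1) :
    ∃ U ∈ Matrix.unitaryGroup (Fin D) ℂ, IsCanonicalBlock fun i => U * A i * Uᴴ := by
  have hA0 : ∃ i, (A i)ᴴ ≠ 0 := by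
    by_contra! hcon
    have : transfer A 1 = 0 := by simp [transfer_apply, hcon]
    exact one_ne_zero (hone.symm.trans this)
  obtain ⟨r, hr, X, hX, heig⟩ := hA.conjTranspose.exists_posDef_eigenvector hA0
  -- The maps for `A_i` and `A_i†` are dual under the trace, so unitality of the former makes the
  -- latter trace preserving; hence `r = 1`.
  have htr : ((r : ℂ) - 1) * X.trace = 0 := by
    have h1 := congrArg Matrix.trace heig
    have h2 : (transfer (fun i => (A i)ᴴ) X).trace = (transfer A 1 * X).trace := by
      simp only [transfer_apply, Matrix.trace_sum, Finset.sum_mul, mul_one,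
        Matrix.conjTranspose_conjTranspose]
      refine Finset.sum_congr rfl fun i _ => ?_
      rw [Matrix.trace_mul_comm, mul_assoc]
    rw [h2, hone, one_mul, Matrix.trace_smul, smul_eq_mul] at h1
    rw [sub_mul, one_mul, ← h1, sub_self]
  have hr1 : (r : ℂ) = 1 := by
    have := hX.trace_pos.ne'
    exact sub_eq_zero.1 ((mul_eq_zero.1 htr).resolve_right this)
  rw [hr1, one_smul] at heig
  obtain ⟨W, hW, Λ, hΛ, hspec⟩ : ∃ W ∈ Matrix.unitaryGroup (Fin D) ℂ, ∃ Λ : Fin D → ℝ,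
      (∀ a, 0 < Λ a) ∧ X = W * Matrix.diagonal (fun a => (Λ a : ℂ)) * Wᴴ :=
    ⟨_, hX.1.eigenvectorUnitary.2, _, fun a => hX.eigenvalues_pos a, hX.1.spectral_theorem⟩
  have hV1 : Wᴴ * W = 1 := hW.1
  have hV2 : W * Wᴴ = 1 := hW.2
  have hB : ∀ i, Wᴴ * A i * Wᴴᴴ = (1 : ℂ) • (Wᴴ * A i * W) := by
    intro i
    rw [one_smul, Matrix.conjTranspose_conjTranspose]
  refine ⟨Wᴴ, Unitary.star_mem hW, ?_, ⟨Λ, hΛ, ?_⟩, ?_⟩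
  · have := transfer_conj hV2 hB 1
    rw [hone] at this
    simpa [transfer_apply, hV1] using this
  · have hdiag : Matrix.diagonal (fun a => (Λ a : ℂ)) = Wᴴ * X * W := by
      rw [hspec]
      simp only [mul_assoc, hV1, mul_one]
      rw [← mul_assoc, hV1, one_mul]
    rw [hdiag]
    have hB' : ∀ i, (Wᴴ * A i * Wᴴᴴ)ᴴ = (1 : ℂ) • (Wᴴ * (A i)ᴴ * W) := by
      intro i
      simp [Matrix.conjTranspose_mul, mul_assoc]
    have := transfer_conj (A := fun i => (A i)ᴴ) (B := fun i => (Wᴴ * A i * Wᴴᴴ)ᴴ) hV2 hB' X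
    rw [heig] at this
    simpa only [transfer_apply, Matrix.conjTranspose_conjTranspose, norm_one, one_pow,
      Complex.ofReal_one, one_smul] using this
  · intro Y hY
    have hC : ∀ i, A i = (1 : ℂ) • (W * (Wᴴ * A i * Wᴴᴴ) * Wᴴ) := by
      intro i
      rw [one_smul, Matrix.conjTranspose_conjTranspose]
      calc A i = (W * Wᴴ) * A i * (W * Wᴴ) := by rw [hV2, one_mul, mul_one]
        _ = _ := by simp only [mul_assoc]
    have h1 := transfer_conj hV1 hC Y
    rw [transfer_apply (fun i => Wᴴ * A i * Wᴴᴴ), hY, norm_one, one_pow, Complex.ofReal_one,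
      one_smul] at h1
    obtain ⟨c, hc⟩ := hA.exists_eq_smul_one hone h1
    refine ⟨c, ?_⟩
    calc Y = (Wᴴ * W) * Y * (Wᴴ * W) := by rw [hV1, one_mul, mul_one]
      _ = Wᴴ * (W * Y * Wᴴ) * W := by simp only [mul_assoc]
      _ = c • 1 := by rw [hc]; simp [hV1]

end PerronFrobenius

/-! ### From a sequence of intertwiners to a single one -/

section Intertwiner

variable {d D : ℕ} {A B : Fin d → Matrix (Fin D) (Fin D) ℂ} {L : ℕ}

/-- If products of the matrices span, the matrices have no common kernel. -/
lemma SpansAt.eq_zero_of_mulVec (hA : SpansAt A L) (hA0 : ∃ i, A i ≠ 0) {v : Fin D → ℂ}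
    (hv : ∀ i, A i *ᵥ v = 0) : v = 0 := by
  by_contra hv0
  obtain ⟨b, hb⟩ := Function.ne_iff.1 hv0
  have hD : (D : ℂ) ≠ 0 := by
    have := b.pos
    exact_mod_cast this.ne'
  cases L with
  | zero =>
    -- The only word of length zero is the identity, so spanning makes every matrix scalar; a
    -- non-zero scalar matrix has no kernel.
    obtain ⟨i, hi⟩ := hA0
    have h : A i - ((A i).trace / D) • (1 : Matrix (Fin D) (Fin D) ℂ) = 0 := by
      refine hA _ fun w hw => ?_
      rw [List.length_eq_zero_iff.1 hw]
      simp [Matrix.trace_sub, hD]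
    rw [sub_eq_zero] at h
    have h2 := hv i
    rw [h, Matrix.smul_mulVec, Matrix.one_mulVec] at h2
    have h3 := (smul_eq_zero.1 h2).resolve_right hv0
    rw [h3, zero_smul] at h
    exact hi h
  | succ L =>
    have h := hA (Matrix.vecMulVec v (star v)) fun w hw => by
      obtain ⟨w, i, rfl⟩ : ∃ w' i, w = w' ++ [i] := by
        rcases List.eq_nil_or_concat' w with rfl | h
        · simp at hw
        · exact h
      rw [Matrix.trace_mul_comm, Matrix.mul_vecMulVec]
      simp [← Matrix.mulVec_mulVec, hv]
    have h3 := congrFun (congrFun h b) b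
    simp only [Matrix.vecMulVec_apply, Pi.star_apply, Matrix.zero_apply, mul_eq_zero,
      star_eq_zero, or_self] at h3
    exact hb h3

/-- A non-zero matrix intertwining a spanning family with another one is invertible. -/
lemma SpansAt.isUnit_of_intertwines (hA : SpansAt A L) {R : Matrix (Fin D) (Fin D) ℂ} (hR : R ≠ 0)
    {μ : ℂ} (h : ∀ i, B i * R = μ • (R * A i)) (hμ : μ ≠ 0) : IsUnit R := by
  rw [← Matrix.mulVec_injective_iff_isUnit]
  rw [← Matrix.coe_mulVecLin, ← LinearMap.ker_eq_bot, LinearMap.ker_eq_bot']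
  intro v hv
  rw [Matrix.mulVecLin_apply] at hv
  -- The kernel of `R` is invariant under all `A_i`. As words span, a non-zero vector in it would
  -- force `R = 0`.
  have hw : ∀ w : List (Fin d), R *ᵥ ((w.map A).prod *ᵥ v) = 0 := by
    intro w
    induction w with
    | nil => simpa using hv
    | cons i w ih =>
      have h1 : R * A i = μ⁻¹ • (B i * R) := by rw [h, smul_smul, inv_mul_cancel₀ hμ, one_smul]
      rw [List.map_cons, List.prod_cons, ← Matrix.mulVec_mulVec, Matrix.mulVec_mulVec, h1,
        Matrix.smul_mulVec, ← Matrix.mulVec_mulVec, ih, Matrix.mulVec_zero, smul_zero]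
  by_contra hv0
  obtain ⟨b, hb⟩ := Function.ne_iff.1 hv0
  apply hR
  ext k a
  have h1 := hA (Matrix.vecMulVec v (R k)) fun w _ => by
    rw [Matrix.trace_mul_comm, Matrix.mul_vecMulVec, Matrix.trace_vecMulVec, dotProduct_comm]
    exact congrFun (hw w) k
  have h3 := congrFun (congrFun h1 b) a
  simp only [Matrix.vecMulVec_apply, Matrix.zero_apply, mul_eq_zero] at h3
  exact h3.resolve_left hb

/-- A subspace that contains the first `dim V` elements of the orbit of a non-zero vector under an
endomorphism of `V` contains an eigenvector. -/
lemma exists_eigenvector_of_pow_mem {V : Type*} [AddCommGroup V] [Module ℂ V]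
    [FiniteDimensional ℂ V] (f : Module.End ℂ V) (W : Submodule ℂ V) {x : V} (hx : x ≠ 0)
    (h : ∀ k < Module.finrank ℂ V, (f ^ k) x ∈ W) :
    ∃ μ : ℂ, ∃ y ∈ W, y ≠ 0 ∧ f y = μ • y := by
  -- By Cayley–Hamilton, reduction modulo the characteristic polynomial leaves only powers below
  -- `dim V`.
  have hmem : ∀ p : Polynomial ℂ, Polynomial.aeval f p x ∈ W := by
    intro p
    have hmonic := f.charpoly_monic
    have h1 : Polynomial.aeval f p x = Polynomial.aeval f (p %ₘ f.charpoly) x := by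
      rw [Polynomial.aeval_modByMonic_eq_self_of_root (f.aeval_self_charpoly)]
    rw [h1]
    by_cases hdim : Module.finrank ℂ V = 0
    · have := Module.finrank_zero_iff.1 hdim
      exact absurd (Subsingleton.elim x 0) hx
    have hdeg : (p %ₘ f.charpoly).natDegree < Module.finrank ℂ V := by
      rw [← f.charpoly_natDegree]
      refine Polynomial.natDegree_modByMonic_lt p hmonic fun h1 => hdim ?_
      rw [← f.charpoly_natDegree, h1, Polynomial.natDegree_one]
    rw [Polynomial.aeval_eq_sum_range, LinearMap.sum_apply]
    refine W.sum_mem fun k hk => ?_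
    rw [LinearMap.smul_apply]
    exact W.smul_mem _ (h k (lt_of_le_of_lt (Nat.lt_succ_iff.1 (Finset.mem_range.1 hk)) hdeg))
  -- The cyclic subspace of `x` is non-zero, invariant and contained in `W`, so `f` has an
  -- eigenvector there.
  let Q : Submodule ℂ V :=
    LinearMap.range ((LinearMap.applyₗ x).comp (Polynomial.aeval (R := ℂ) f).toLinearMap)
  have hQW : Q ≤ W := by
    rintro _ ⟨p, rfl⟩
    exact hmem p
  have hxQ : x ∈ Q := ⟨1, by simp⟩
  have hfQ : ∀ y ∈ Q, f y ∈ Q := by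
    rintro _ ⟨p, rfl⟩
    exact ⟨Polynomial.X * p, by simp⟩
  have : Nontrivial Q := ⟨⟨⟨x, hxQ⟩, 0, fun h0 => hx (congrArg Subtype.val h0)⟩⟩
  obtain ⟨μ, hμ⟩ := Module.End.exists_eigenvalue (f.restrict hfQ)
  obtain ⟨y, hy⟩ := hμ.exists_hasEigenvector
  refine ⟨μ, y, hQW y.2, fun h0 => hy.2 (Subtype.ext h0), ?_⟩
  exact congrArg Subtype.val hy.apply_eq_smul

/-- A sequence of `D ^ 4 + 1` matrices that intertwines `A ⊗ 1` with `B ⊗ 1` on `D ^ 4` successive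
sites yields a site-independent intertwiner. -/
theorem SpansAt.exists_similar_of_chain (hA : SpansAt A L) (hone : transfer A 1 = 1)
    (hB : ∀ v : Fin D → ℂ, (∀ i, B i *ᵥ v = 0) → v = 0)
    (P : ℕ → Matrix (Fin D × Fin D) (Fin D × Fin D) ℂ)
    (hP : ∀ k < D ^ 4, ∀ i, (B i ⊗ₖ (1 : Matrix (Fin D) (Fin D) ℂ)) * P (k + 1) =
      P k * (A i ⊗ₖ (1 : Matrix (Fin D) (Fin D) ℂ)))
    (hP0 : P (D ^ 4) ≠ 0) :
    ∃ μ : ℂ, μ ≠ 0 ∧ ∃ R S : Matrix (Fin D) (Fin D) ℂ, R * S = 1 ∧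
      ∀ i, B i = μ • (R * A i * S) := by
  have hsum : ∑ i, A i * (A i)ᴴ = 1 := by simpa [transfer_apply] using hone
  set one : Matrix (Fin D) (Fin D) ℂ := 1 with hone'
  have hone2 : ∑ i, (A i ⊗ₖ one) * ((A i)ᴴ ⊗ₖ one) = 1 := by
    simp only [← Matrix.mul_kronecker_mul]
    rw [← Matrix.one_kronecker_one, hone', mul_one, show (1 : Matrix (Fin D) (Fin D) ℂ) ⊗ₖ (1 : Matrix (Fin D) (Fin D) ℂ) =
      (∑ i, A i * (A i)ᴴ) ⊗ₖ 1 by rw [hsum, hone']]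
    ext ⟨a, b⟩ ⟨a', b'⟩
    simp [Matrix.sum_apply, Finset.sum_mul]
  let T : Module.End ℂ (Matrix (Fin D × Fin D) (Fin D × Fin D) ℂ) :=
    { toFun := fun X => ∑ i, (B i ⊗ₖ one) * X * ((A i)ᴴ ⊗ₖ one)
      map_add' := fun X Y => by simp [mul_add, add_mul, Finset.sum_add_distrib]
      map_smul' := fun c X => by simp [Finset.smul_sum] }
  have hT : ∀ X, T X = ∑ i, (B i ⊗ₖ one) * X * ((A i)ᴴ ⊗ₖ one) := fun X => rfl
  -- If `X` intertwines at all with some partner to its left, unitality forces the partner to be `T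
  -- X`. On an eigenvector of `T` in `W` the two coincide up to the eigenvalue.
  let W : Submodule ℂ (Matrix (Fin D × Fin D) (Fin D × Fin D) ℂ) :=
    { carrier := {X | ∀ i, (B i ⊗ₖ one) * X = T X * (A i ⊗ₖ one)}
      add_mem' := fun {X Y} hX hY i => by rw [mul_add, map_add, add_mul, hX, hY]
      zero_mem' := fun i => by simp
      smul_mem' := fun c X hX i => by rw [map_smul, Matrix.mul_smul, hX, Matrix.smul_mul] }
  have hTP : ∀ k < D ^ 4, T (P (k + 1)) = P k := by
    intro k hk
    rw [hT]
    simp only [hP k hk]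
    simp only [mul_assoc]
    rw [← Finset.mul_sum, hone2, mul_one]
  have hpow : ∀ k ≤ D ^ 4, (T ^ k) (P (D ^ 4)) = P (D ^ 4 - k) := by
    intro k
    induction k with
    | zero => simp
    | succ k ih =>
      intro hk
      rw [pow_succ', Module.End.mul_apply, ih (by omega),
        show D ^ 4 - k = (D ^ 4 - (k + 1)) + 1 by omega, hTP _ (by omega)]
  have hfin : Module.finrank ℂ (Matrix (Fin D × Fin D) (Fin D × Fin D) ℂ) = D ^ 4 := by
    rw [Module.finrank_matrix]
    simp
    ring
  obtain ⟨μ, X, hXW, hX0, hXμ⟩ := exists_eigenvector_of_pow_mem T W hP0 (by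
    rw [hfin]
    intro k hk i
    rw [hpow k hk.le, show D ^ 4 - k = (D ^ 4 - k - 1) + 1 by omega, hTP _ (by omega),
      hP _ (by omega)])
  -- The factors `⊗ 1` act trivially on the second indices; fixing these gives `D × D` intertwiners.
  have hslice : ∀ (b b' : Fin D) (i : Fin d), B i * (Matrix.of fun a a' => X (a, b) (a', b')) =
      μ • ((Matrix.of fun a a' => X (a, b) (a', b')) * A i) := by
    intro b b' i
    have h1 := hXW i
    rw [hXμ] at h1
    ext a a'
    have h2 := congrFun (congrFun h1 (a, b)) (a', b')
    simpa [Matrix.mul_apply, Fintype.sum_prod_type, Matrix.kroneckerMap_apply, hone',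
      Matrix.one_apply, Finset.mul_sum, mul_assoc] using h2
  obtain ⟨b, b', hbb⟩ : ∃ b b', (Matrix.of fun a a' => X (a, b) (a', b')) ≠ 0 := by
    by_contra! hcon
    apply hX0
    ext ⟨a, b⟩ ⟨a', b'⟩
    exact congrFun (congrFun (hcon b b') a) a'
  set R : Matrix (Fin D) (Fin D) ℂ := Matrix.of fun a a' => X (a, b) (a', b') with hR
  have hBR := hslice b b'
  have hμ : μ ≠ 0 := by
    rintro rfl
    apply hbb
    refine Matrix.ext_of_mulVec_single fun k => ?_
    rw [Matrix.zero_mulVec]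
    refine hB _ fun i => ?_
    rw [Matrix.mulVec_mulVec, hBR i, zero_smul, Matrix.zero_mulVec]
  have hRu := hA.isUnit_of_intertwines hbb hBR hμ
  refine ⟨μ, hμ, R, R⁻¹, ?_, fun i => ?_⟩
  · exact Matrix.mul_nonsing_inv R ((Matrix.isUnit_iff_isUnit_det R).1 hRu)
  · rw [← Matrix.smul_mul, ← hBR i, mul_assoc,
      Matrix.mul_nonsing_inv R ((Matrix.isUnit_iff_isUnit_det R).1 hRu), mul_one]

end Intertwiner

/-! ### Minimal matrix product chains and their gauges -/

/-- A matrix product with boundary vectors, whose bonds carry arbitrary finite index types. -/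
structure Chain (d N : ℕ) where
  ι : Fin (N + 1) → Type
  [fintype : ∀ m, Fintype (ι m)]
  [decEq : ∀ m, DecidableEq (ι m)]
  mat : (m : Fin N) → Fin d → Matrix (ι m.castSucc) (ι m.succ) ℂ
  first : ι 0 → ℂ
  last : ι (Fin.last N) → ℂ

namespace Chain

attribute [instance] Chain.fintype Chain.decEq

variable {d N : ℕ}

/-- The row vector on the bond `m` that the sites to the left of it produce. -/
noncomputable def left (K : Chain d N) (s : Fin N → Fin d) (m : Fin (N + 1)) : K.ι m → ℂ :=
  Fin.induction (motive := fun m => K.ι m → ℂ) K.first (fun m v => v ᵥ* K.mat m (s m)) m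

/-- The column vector on the bond `m` that the sites to the right of it produce. -/
noncomputable def right (K : Chain d N) (s : Fin N → Fin d) (m : Fin (N + 1)) : K.ι m → ℂ :=
  Fin.reverseInduction (motive := fun m => K.ι m → ℂ) K.last (fun m v => K.mat m (s m) *ᵥ v) m

/-- The vector of `(ℂ^d)^{⊗N}` that a chain represents. -/
noncomputable def value (K : Chain d N) : Vec d N :=
  fun s => K.left s (Fin.last N) ⬝ᵥ K.last

@[simp] lemma left_zero (K : Chain d N) (s : Fin N → Fin d) : K.left s 0 = K.first := rfl

lemma left_succ (K : Chain d N) (s : Fin N → Fin d) (m : Fin N) :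
    K.left s m.succ = K.left s m.castSucc ᵥ* K.mat m (s m) := rfl

@[simp] lemma right_last (K : Chain d N) (s : Fin N → Fin d) :
    K.right s (Fin.last N) = K.last := by
  simp [right]

lemma right_castSucc (K : Chain d N) (s : Fin N → Fin d) (m : Fin N) :
    K.right s m.castSucc = K.mat m (s m) *ᵥ K.right s m.succ := by
  simp [right]

lemma left_dotProduct_right (K : Chain d N) (s : Fin N → Fin d) (m : Fin (N + 1)) :
    K.left s m ⬝ᵥ K.right s m = K.value s := by
  induction m using Fin.reverseInduction with
  | last => rw [right_last, value]
  | cast m ih => rw [right_castSucc, Matrix.dotProduct_mulVec, ← left_succ, ih]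

lemma left_congr (K : Chain d N) {s t : Fin N → Fin d} (m : Fin (N + 1))
    (h : ∀ k : Fin N, k.val < m.val → s k = t k) : K.left s m = K.left t m := by
  induction m using Fin.induction with
  | zero => rfl
  | succ m ih =>
    rw [left_succ, left_succ, h m (by simp), ih fun k hk => h k (by simp at hk ⊢; omega)]

lemma right_congr (K : Chain d N) {s t : Fin N → Fin d} (m : Fin (N + 1))
    (h : ∀ k : Fin N, m.val ≤ k.val → s k = t k) : K.right s m = K.right t m := by
  induction m using Fin.reverseInduction with
  | last => rw [right_last, right_last]
  | cast m ih =>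
    rw [right_castSucc, right_castSucc, h m (by simp),
      ih fun k hk => h k (by simp at hk ⊢; omega)]

/-- The vectors from the left span the bond space. -/
def LeftFull (K : Chain d N) (m : Fin (N + 1)) : Prop :=
  ∀ v, (∀ s, K.left s m ⬝ᵥ v = 0) → v = 0

/-- The vectors from the right span the bond space. -/
def RightFull (K : Chain d N) (m : Fin (N + 1)) : Prop :=
  ∀ v, (∀ s, v ⬝ᵥ K.right s m = 0) → v = 0

/-- The vectors from the left as the rows of a matrix. -/
noncomputable def leftMat (K : Chain d N) (m : Fin (N + 1)) :
    Matrix (Fin N → Fin d) (K.ι m) ℂ :=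
  Matrix.of fun s => K.left s m

/-- The vectors from the right as the columns of a matrix. -/
noncomputable def rightMat (K : Chain d N) (m : Fin (N + 1)) :
    Matrix (K.ι m) (Fin N → Fin d) ℂ :=
  Matrix.of fun a s => K.right s m a

/-- Across each bond the coefficients factor through the bond space, and the product depends only on
the value of the chain. This lets two chains be compared. -/
lemma leftMat_mul_rightMat_apply (K : Chain d N) (m : Fin (N + 1)) (s t : Fin N → Fin d) :
    (K.leftMat m * K.rightMat m) s t =
      K.value fun k => if k.val < m.val then s k else t k := by
  rw [← left_dotProduct_right _ _ m,
    K.left_congr (t := s) m fun k hk => if_pos hk,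
    K.right_congr (t := t) m fun k hk => if_neg (by omega)]
  rfl

lemma leftMat_mul_mat_mul_rightMat_apply (K : Chain d N) (m : Fin N) (i : Fin d)
    (s t : Fin N → Fin d) :
    (K.leftMat m.castSucc * K.mat m i * K.rightMat m.succ) s t =
      K.value fun k => if k.val < m.val then s k else if k = m then i else t k := by
  have hl : K.left (fun k => if k.val < m.val then s k else if k = m then i else t k)
      m.castSucc = K.left s m.castSucc := K.left_congr m.castSucc fun k hk => if_pos hk
  have hr : K.right (fun k => if k.val < m.val then s k else if k = m then i else t k)
      m.succ = K.right t m.succ := K.right_congr m.succ fun k hk => by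
    rw [Fin.val_succ] at hk
    rw [if_neg (by omega), if_neg (by rintro rfl; omega)]
  rw [← left_dotProduct_right _ _ m.succ, left_succ, hl, hr]
  simp only [lt_irrefl, if_false, if_true]
  rfl

lemma LeftFull.exists_leftInverse {K : Chain d N} {m : Fin (N + 1)} (h : K.LeftFull m) :
    ∃ L : Matrix (K.ι m) (Fin N → Fin d) ℂ, L * K.leftMat m = 1 := by
  obtain ⟨g, hg⟩ := (Matrix.toLin' (K.leftMat m)).exists_leftInverse_of_injective
    (LinearMap.ker_eq_bot'.2 fun v hv => h v fun s => congrFun hv s)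
  refine ⟨LinearMap.toMatrix' g, ?_⟩
  rw [← LinearMap.toMatrix'_toLin' (K.leftMat m), ← LinearMap.toMatrix'_comp, hg,
    LinearMap.toMatrix'_id]

lemma RightFull.exists_rightInverse {K : Chain d N} {m : Fin (N + 1)} (h : K.RightFull m) :
    ∃ L : Matrix (Fin N → Fin d) (K.ι m) ℂ, K.rightMat m * L = 1 := by
  obtain ⟨g, hg⟩ := (Matrix.toLin' (K.rightMat m)ᵀ).exists_leftInverse_of_injective
    (LinearMap.ker_eq_bot'.2 fun v hv => h v fun s => by
      rw [dotProduct_comm]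
      exact congrFun hv s)
  refine ⟨(LinearMap.toMatrix' g)ᵀ, ?_⟩
  rw [← Matrix.transpose_transpose (K.rightMat m), ← Matrix.transpose_mul,
    ← LinearMap.toMatrix'_toLin' (K.rightMat m)ᵀ, ← LinearMap.toMatrix'_comp, hg,
    LinearMap.toMatrix'_id, Matrix.transpose_one]

/-- `G`, with inverse `G'`, translates between the bond spaces of two chains. -/
structure IsGauge (K K' : Chain d N) (m : Fin (N + 1)) (G : Matrix (K.ι m) (K'.ι m) ℂ)
    (G' : Matrix (K'.ι m) (K.ι m) ℂ) : Prop where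
  mul_eq_one : G * G' = 1
  mul_eq_one' : G' * G = 1
  leftMat_mul : K.leftMat m * G = K'.leftMat m
  mul_rightMat : G * K'.rightMat m = K.rightMat m

/-- Both chains give full-rank factorizations of the same matrix, and such factorizations differ by
an invertible matrix. The one-sided inverses of the outer factors produce it. -/
theorem exists_isGauge {K K' : Chain d N} (hval : K.value = K'.value) {m : Fin (N + 1)}
    (hl : K.LeftFull m) (hr : K.RightFull m) (hl' : K'.LeftFull m) (hr' : K'.RightFull m) :
    ∃ G G', IsGauge K K' m G G' := by
  have h : K.leftMat m * K.rightMat m = K'.leftMat m * K'.rightMat m := by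
    ext s t
    rw [leftMat_mul_rightMat_apply, leftMat_mul_rightMat_apply, hval]
  obtain ⟨L, hL⟩ := hl.exists_leftInverse
  obtain ⟨R, hR⟩ := hr.exists_rightInverse
  obtain ⟨L', hL'⟩ := hl'.exists_leftInverse
  obtain ⟨R', hR'⟩ := hr'.exists_rightInverse
  have h1 : L * K'.leftMat m * K'.rightMat m = K.rightMat m := by
    rw [Matrix.mul_assoc, ← h, ← Matrix.mul_assoc, hL, Matrix.one_mul]
  have h2 : L' * K.leftMat m * K.rightMat m = K'.rightMat m := by
    rw [Matrix.mul_assoc, h, ← Matrix.mul_assoc, hL', Matrix.one_mul]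
  have h3 : L * K'.leftMat m * (L' * K.leftMat m) = 1 := by
    rw [← Matrix.mul_one (L * K'.leftMat m * (L' * K.leftMat m)), ← hR, ← Matrix.mul_assoc,
      Matrix.mul_assoc (L * K'.leftMat m), h2, h1]
  have h4 : L' * K.leftMat m * (L * K'.leftMat m) = 1 := by
    rw [← Matrix.mul_one (L' * K.leftMat m * (L * K'.leftMat m)), ← hR', ← Matrix.mul_assoc,
      Matrix.mul_assoc (L' * K.leftMat m), h1, h2]
  refine ⟨L * K'.leftMat m, L' * K.leftMat m, h3, h4, ?_, h1⟩
  have h5 : K.leftMat m = K'.leftMat m * (L' * K.leftMat m) := by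
    calc K.leftMat m = K.leftMat m * (K.rightMat m * R) := by rw [hR, Matrix.mul_one]
      _ = K'.leftMat m * (L' * K.leftMat m * K.rightMat m) * R := by
          rw [h2, ← h, Matrix.mul_assoc]
      _ = K'.leftMat m * (L' * K.leftMat m) * (K.rightMat m * R) := by
          simp only [Matrix.mul_assoc]
      _ = _ := by rw [hR, Matrix.mul_one]
  conv_lhs => rw [h5]
  rw [Matrix.mul_assoc, h4, Matrix.mul_one]

/-- Gauges on neighbouring bonds relate the matrices of the site between them. -/
theorem IsGauge.mat_mul {K K' : Chain d N} (hval : K.value = K'.value) {m : Fin N}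
    (hl : K.LeftFull m.castSucc) (hr' : K'.RightFull m.succ) {G G' G₁ G₁'}
    (h : IsGauge K K' m.castSucc G G') (h₁ : IsGauge K K' m.succ G₁ G₁') (i : Fin d) :
    K.mat m i * G₁ = G * K'.mat m i := by
  obtain ⟨L, hL⟩ := hl.exists_leftInverse
  obtain ⟨R', hR'⟩ := hr'.exists_rightInverse
  have h1 : K.leftMat m.castSucc * K.mat m i * K.rightMat m.succ =
      K'.leftMat m.castSucc * K'.mat m i * K'.rightMat m.succ := by
    ext s t
    rw [leftMat_mul_mat_mul_rightMat_apply, leftMat_mul_mat_mul_rightMat_apply, hval]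
  rw [← h₁.mul_rightMat, ← h.leftMat_mul] at h1
  have h2 := congrArg (fun M => L * M * R') h1
  calc K.mat m i * G₁
      = (L * K.leftMat m.castSucc) * K.mat m i * G₁ * (K'.rightMat m.succ * R') := by
        rw [hL, hR', Matrix.mul_one, Matrix.one_mul]
    _ = (L * K.leftMat m.castSucc) * G * K'.mat m i * (K'.rightMat m.succ * R') := by
        simpa only [Matrix.mul_assoc] using h2
    _ = _ := by rw [hL, hR', Matrix.mul_one, Matrix.one_mul]

/-- If two chains with the same value have bond spaces of the same dimension and one of them is
minimal there, then so is the other one. -/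
theorem leftFull_of_minimal {K K' : Chain d N} (hval : K.value = K'.value) {m : Fin (N + 1)}
    (hl : K.LeftFull m) (hr : K.RightFull m)
    (hcard : Fintype.card (K.ι m) = Fintype.card (K'.ι m)) : K'.LeftFull m := by
  have h : K.leftMat m * K.rightMat m = K'.leftMat m * K'.rightMat m := by
    ext s t
    rw [leftMat_mul_rightMat_apply, leftMat_mul_rightMat_apply, hval]
  obtain ⟨L, hL⟩ := hl.exists_leftInverse
  obtain ⟨R, hR⟩ := hr.exists_rightInverse
  have h1 : (L * K'.leftMat m) * (K'.rightMat m * R) = 1 := by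
    calc (L * K'.leftMat m) * (K'.rightMat m * R)
        = L * (K'.leftMat m * K'.rightMat m) * R := by simp only [Matrix.mul_assoc]
      _ = (L * K.leftMat m) * (K.rightMat m * R) := by rw [← h]; simp only [Matrix.mul_assoc]
      _ = 1 := by rw [hL, hR, Matrix.mul_one]
  -- Equal bond dimensions turn the one-sided inverse into a two-sided one, so `K'.leftMat m` is
  -- injective.
  have h2 := (Matrix.mul_eq_one_comm_of_card_eq _ _ _ hcard).1 h1
  intro v hv
  have h3 : K'.leftMat m *ᵥ v = 0 := funext hv
  rw [← Matrix.one_mulVec v, ← h2, ← Matrix.mulVec_mulVec, ← Matrix.mulVec_mulVec _ L, h3,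
    Matrix.mulVec_zero, Matrix.mulVec_zero]

lemma LeftFull.succ {K : Chain d N} {m : Fin N} (h : K.LeftFull m.castSucc)
    (hm : ∀ v, (∀ i, K.mat m i *ᵥ v = 0) → v = 0) : K.LeftFull m.succ := by
  refine fun v hv => hm v fun i => h _ fun s => ?_
  have h2 := hv (Function.update s m i)
  have h3 : K.left (Function.update s m i) m.castSucc = K.left s m.castSucc :=
    K.left_congr m.castSucc fun k hk => Function.update_of_ne (by rintro rfl; simp at hk) _ _
  rwa [left_succ, Function.update_self, ← Matrix.dotProduct_mulVec, h3] at h2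

lemma RightFull.castSucc {K : Chain d N} {m : Fin N} (h : K.RightFull m.succ)
    (hm : ∀ v, (∀ i, v ᵥ* K.mat m i = 0) → v = 0) : K.RightFull m.castSucc := by
  refine fun v hv => hm v fun i => h _ fun s => ?_
  have h2 := hv (Function.update s m i)
  have h3 : K.right (Function.update s m i) m.succ = K.right s m.succ :=
    K.right_congr m.succ fun k hk => Function.update_of_ne (by rintro rfl; simp at hk) _ _
  rwa [right_castSucc, Function.update_self, Matrix.dotProduct_mulVec, h3] at h2

end Chain

/-! ### Minimality of the OBC canonical form -/

section OBC

variable {d N : ℕ}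

/-- The chain of an OBC representation. -/
noncomputable def OBCForm.toChain (F : OBCForm d N) : Chain d N where
  ι m := Fin (F.dim m)
  mat := F.mat
  first _ := 1
  last _ := 1

lemma OBCForm.toChain_left (F : OBCForm d N) (s : Fin N → Fin d) (m : Fin (N + 1)) :
    F.toChain.left s m = F.partialProd s m (Fin.cast F.dim_zero.symm 0) := by
  induction m using Fin.induction with
  | zero =>
    funext a
    have h : a = Fin.cast F.dim_zero.symm 0 :=
      (finCongr F.dim_zero).injective (Subsingleton.elim _ _)
    rw [h]
    exact (Matrix.one_apply_eq _).symm
  | succ m ih =>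
    rw [Chain.left_succ, ih]
    rfl

lemma OBCForm.toChain_value (F : OBCForm d N) : F.toChain.value = F.toVec := by
  funext s
  rw [Chain.value, OBCForm.toChain_left]
  refine (Fintype.sum_eq_single (Fin.cast F.dim_last.symm 0) fun a ha => (ha ?_).elim).trans ?_
  · exact (finCongr F.dim_last).injective (Subsingleton.elim _ _)
  · exact mul_one _

/-- A common kernel vector of the matrices of a site is annihilated by `∑ A† Λ A`, which is the
invertible diagonal matrix of the next bond. So fullness passes from bond to bond. -/
lemma OBCForm.IsCanonical.leftFull {F : OBCForm d N} (hF : F.IsCanonical)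
    (s₀ : Fin N → Fin d) (m : Fin (N + 1)) : F.toChain.LeftFull m := by
  obtain ⟨-, Λ, hΛ, hpos, -⟩ := hF
  induction m using Fin.induction with
  | zero =>
    intro (v : Fin (F.dim 0) → ℂ) hv
    funext (a : Fin (F.dim 0))
    have h : ∑ b : Fin (F.dim 0), (1 : ℂ) * v b = 0 := hv s₀
    rw [Fintype.sum_eq_single a fun b hb => (hb
      ((finCongr F.dim_zero).injective (Subsingleton.elim _ _))).elim, one_mul] at h
    exact h
  | succ m ih =>
    refine ih.succ fun (v : Fin (F.dim m.succ) → ℂ) (h1 : ∀ i, F.mat m i *ᵥ v = 0) => ?_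
    have h2 : (∑ i, (F.mat m i)ᴴ * Matrix.diagonal (fun α => (Λ m.castSucc α : ℂ)) *
        F.mat m i) *ᵥ v = Matrix.diagonal (fun α => (Λ m.succ α : ℂ)) *ᵥ v := by rw [hΛ m]
    simp only [Matrix.sum_mulVec, ← Matrix.mulVec_mulVec, h1, Matrix.mulVec_zero,
      Finset.sum_const_zero] at h2
    funext a
    have h3 := congrFun h2.symm a
    rw [Matrix.mulVec_diagonal] at h3
    have h4 : (Λ m.succ a : ℂ) ≠ 0 := by exact_mod_cast (hpos m.succ a).ne'
    exact (mul_eq_zero.1 h3).resolve_left h4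

/-- Here `∑ A A† = 1` excludes a common left kernel, and fullness passes from right to left. -/
lemma OBCForm.IsCanonical.rightFull {F : OBCForm d N} (hF : F.IsCanonical)
    (s₀ : Fin N → Fin d) (m : Fin (N + 1)) : F.toChain.RightFull m := by
  obtain ⟨hone, -⟩ := hF
  induction m using Fin.reverseInduction with
  | last =>
    intro (v : Fin (F.dim (Fin.last N)) → ℂ) hv
    funext (a : Fin (F.dim (Fin.last N)))
    have h := hv s₀
    rw [Chain.right_last] at h
    replace h : ∑ b : Fin (F.dim (Fin.last N)), v b * (1 : ℂ) = 0 := h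
    rw [Fintype.sum_eq_single a fun b hb => (hb
      ((finCongr F.dim_last).injective (Subsingleton.elim _ _))).elim, mul_one] at h
    exact h
  | cast m ih =>
    refine ih.castSucc fun (v : Fin (F.dim m.castSucc) → ℂ) (h1 : ∀ i, v ᵥ* F.mat m i = 0) => ?_
    have h2 : v ᵥ* (∑ i, F.mat m i * (F.mat m i)ᴴ) = v := by rw [hone m, Matrix.vecMul_one]
    rw [← h2, Matrix.vecMul_sum]
    simp only [← Matrix.vecMul_vecMul, h1, Matrix.zero_vecMul, Finset.sum_const_zero]
    rfl

end OBC

/-! ### The ring cut open: TI representations as chains -/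

section TI

variable {d N D : ℕ}

/-- The chain of a TI representation, with the pairs of bond indices of the two ends of a segment as
bond space. -/
noncomputable def tiChain (N : ℕ) (A : Fin d → Matrix (Fin D) (Fin D) ℂ) (c : ℂ) : Chain d N where
  ι _ := Fin D × Fin D
  mat _ i := A i ⊗ₖ (1 : Matrix (Fin D) (Fin D) ℂ)
  first p := c * (1 : Matrix (Fin D) (Fin D) ℂ) p.2 p.1
  last p := (1 : Matrix (Fin D) (Fin D) ℂ) p.1 p.2

lemma tiChain_left (A : Fin d → Matrix (Fin D) (Fin D) ℂ) (c : ℂ) (s : Fin N → Fin d)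
    (m : Fin (N + 1)) : (tiChain N A c).left s m =
      fun p : Fin D × Fin D => c * (((List.ofFn s).take m.val).map A).prod p.2 p.1 := by
  induction m using Fin.induction with
  | zero => rfl
  | succ m ih =>
    have htake : (List.ofFn s).take m.succ.val = (List.ofFn s).take m.castSucc.val ++ [s m] := by
      rw [Fin.val_succ, Fin.val_castSucc, List.take_add_one]
      simp
    rw [Chain.left_succ, ih, htake]
    funext (p : Fin D × Fin D)
    obtain ⟨a, b⟩ := p
    change ∑ q : Fin D × Fin D, c * _ * (A (s m) ⊗ₖ (1 : Matrix (Fin D) (Fin D) ℂ)) q (a, b) = _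
    simp [Fintype.sum_prod_type, Matrix.mul_apply, Matrix.one_apply, Finset.mul_sum, mul_assoc]

lemma tiChain_right (A : Fin d → Matrix (Fin D) (Fin D) ℂ) (c : ℂ) (s : Fin N → Fin d)
    (m : Fin (N + 1)) : (tiChain N A c).right s m =
      fun p : Fin D × Fin D => (((List.ofFn s).drop m.val).map A).prod p.1 p.2 := by
  induction m using Fin.reverseInduction with
  | last =>
    rw [Chain.right_last, List.drop_of_length_le (by simp)]
    rfl
  | cast m ih =>
    have hdrop : (List.ofFn s).drop m.castSucc.val = s m :: (List.ofFn s).drop m.succ.val := by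
      rw [Fin.val_succ, Fin.val_castSucc, List.drop_eq_getElem_cons (by simp)]
      simp
    rw [Chain.right_castSucc, ih, hdrop]
    funext (p : Fin D × Fin D)
    obtain ⟨a, b⟩ := p
    change ∑ q : Fin D × Fin D, (A (s m) ⊗ₖ (1 : Matrix (Fin D) (Fin D) ℂ)) (a, b) q * _ = _
    simp [Fintype.sum_prod_type, Matrix.mul_apply, Matrix.one_apply]

lemma tiChain_value (A : Fin d → Matrix (Fin D) (Fin D) ℂ) (c : ℂ) :
    (tiChain N A c).value = c • tiVec N A := by
  funext s
  rw [Chain.value, tiChain_left, List.take_of_length_le (by simp)]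
  change ∑ q : Fin D × Fin D, c * _ * (1 : Matrix (Fin D) (Fin D) ℂ) q.1 q.2 = c * _
  rw [List.map_ofFn]
  simp [Fintype.sum_prod_type, Matrix.one_apply, Matrix.trace, word, Finset.mul_sum,
    Function.comp_def, tiVec]

lemma exists_take_ofFn (s₀ : Fin N → Fin d) (w : List (Fin d)) (hw : w.length ≤ N) :
    ∃ s : Fin N → Fin d, (List.ofFn s).take w.length = w := by
  refine ⟨fun k => w.getD k (s₀ k), List.ext_getElem (by simpa) fun k h1 h2 => ?_⟩
  simp [h2]

lemma exists_drop_ofFn (s₀ : Fin N → Fin d) (w : List (Fin d)) (m : ℕ) (hw : m + w.length = N) :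
    ∃ s : Fin N → Fin d, (List.ofFn s).drop m = w := by
  refine ⟨fun k => w.getD (k - m) (s₀ k), List.ext_getElem (by simp; omega) fun k h1 h2 => ?_⟩
  simp [h2]

lemma SpansAt.leftFull {A : Fin d → Matrix (Fin D) (Fin D) ℂ} {m : Fin (N + 1)}
    (hA : SpansAt A m) (s₀ : Fin N → Fin d) {c : ℂ} (hc : c ≠ 0) :
    (tiChain N A c).LeftFull m := by
  intro (v : Fin D × Fin D → ℂ) hv
  have h := hA (Matrix.of fun a b => v (a, b)) fun w hw => by
    obtain ⟨s, hs⟩ := exists_take_ofFn s₀ w (by omega)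
    have h1 := hv s
    rw [tiChain_left, ← hw, hs] at h1
    replace h1 : ∑ q : Fin D × Fin D, c * (w.map A).prod q.2 q.1 * v q = 0 := h1
    simp only [mul_assoc, ← Finset.mul_sum] at h1
    rw [← (mul_eq_zero.1 h1).resolve_left hc, Fintype.sum_prod_type]
    simp [Matrix.trace, Matrix.mul_apply, mul_comm]
  funext p
  exact congrFun (congrFun h p.1) p.2

lemma SpansAt.rightFull {A : Fin d → Matrix (Fin D) (Fin D) ℂ} {m : Fin (N + 1)}
    (hA : SpansAt A (N - m)) (s₀ : Fin N → Fin d) {c : ℂ} :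
    (tiChain N A c).RightFull m := by
  intro (v : Fin D × Fin D → ℂ) hv
  have h := hA (Matrix.of fun a b => v (b, a)) fun w hw => by
    obtain ⟨s, hs⟩ := exists_drop_ofFn s₀ w m.val (by omega)
    have h1 := hv s
    rw [tiChain_right, hs] at h1
    replace h1 : ∑ q : Fin D × Fin D, v q * (w.map A).prod q.1 q.2 = 0 := h1
    rw [← h1, Fintype.sum_prod_type, Finset.sum_comm]
    simp [Matrix.trace, Matrix.mul_apply]
  funext p
  exact congrFun (congrFun h p.2) p.1

lemma spansAt_of_leftFull {A : Fin d → Matrix (Fin D) (Fin D) ℂ} {m : Fin (N + 1)} {c : ℂ}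
    (h : (tiChain N A c).LeftFull m) : SpansAt A m := by
  intro X hX
  have h0 := h (fun p : Fin D × Fin D => X p.1 p.2) fun s => by
    rw [tiChain_left]
    change ∑ q : Fin D × Fin D, c * _ * X q.1 q.2 = 0
    have h1 := hX ((List.ofFn s).take m.val) (by simp; omega)
    simp only [mul_assoc, ← Finset.mul_sum]
    rw [mul_eq_zero]
    right
    rw [← h1, Fintype.sum_prod_type]
    simp [Matrix.trace, Matrix.mul_apply, mul_comm]
  ext a b
  exact congrFun h0 (a, b)

lemma ConditionC1.spansAt {A : Fin d → Matrix (Fin D) (Fin D) ℂ} {L : ℕ} (h : ConditionC1 A L) :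
    SpansAt A L := by
  refine fun X hX => h (funext fun s => ?_)
  have := hX (List.ofFn s) (by simp)
  rw [List.map_ofFn] at this
  simpa [Gam, word, Function.comp_def] using this

/-- Unitality writes `X` as `∑ X A_i A_i†`, so `X` vanishes once all `X A_i` do; this adds one
letter to the words. -/
lemma SpansAt.mono {A : Fin d → Matrix (Fin D) (Fin D) ℂ} {L L' : ℕ} (hA : SpansAt A L)
    (hone : transfer A 1 = 1) (hLL' : L ≤ L') : SpansAt A L' := by
  induction L', hLL' using Nat.le_induction with
  | base => exact hA
  | succ L' _ ih =>
    intro X hX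
    have h1 : ∀ i, X * A i = 0 := fun i => ih _ fun w hw => by
      simpa [mul_assoc] using hX (i :: w) (by simp [hw])
    calc X = X * transfer A 1 := by rw [hone, mul_one]
      _ = 0 := by simp [transfer_apply, Finset.mul_sum, ← mul_assoc, h1]

end TI

/-! ### Invariance under similarity and the unital gauge -/

section Similarity

variable {d D N L : ℕ} {A B : Fin d → Matrix (Fin D) (Fin D) ℂ} {R S : Matrix (Fin D) (Fin D) ℂ}
  {μ : ℂ}

lemma prod_map_of_similar (hRS : R * S = 1) (h : ∀ i, B i = μ • (R * A i * S))
    (w : List (Fin d)) : (w.map B).prod = μ ^ w.length • (R * (w.map A).prod * S) := by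
  have hSR : S * R = 1 := mul_eq_one_comm.1 hRS
  induction w with
  | nil => simp [hRS]
  | cons i w ih =>
    rw [List.map_cons, List.prod_cons, ih, h, List.map_cons, List.prod_cons, List.length_cons,
      Matrix.smul_mul, Matrix.mul_smul, smul_smul, pow_succ']
    congr 1
    calc R * A i * S * (R * (w.map A).prod * S) = R * A i * (S * R) * (w.map A).prod * S := by
          simp only [mul_assoc]
      _ = _ := by rw [hSR]; simp only [mul_assoc, mul_one]

lemma tiVec_of_similar (hRS : R * S = 1) (h : ∀ i, B i = μ • (R * A i * S)) :
    tiVec N B = μ ^ N • tiVec N A := by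
  have hSR : S * R = 1 := mul_eq_one_comm.1 hRS
  funext s
  have h1 := prod_map_of_similar hRS h (List.ofFn s)
  rw [List.map_ofFn, List.map_ofFn, List.length_ofFn] at h1
  change (List.ofFn (B ∘ s)).prod.trace = μ ^ N * (List.ofFn (A ∘ s)).prod.trace
  rw [h1, Matrix.trace_smul, Matrix.trace_mul_comm, ← mul_assoc, hSR, one_mul, smul_eq_mul]

lemma SpansAt.of_similar (hA : SpansAt A L) (hRS : R * S = 1)
    (h : ∀ i, B i = μ • (R * A i * S)) (hμ : μ ≠ 0) : SpansAt B L := by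
  have hSR : S * R = 1 := mul_eq_one_comm.1 hRS
  intro X hX
  have h0 : S * X * R = 0 := hA _ fun w hw => by
    have h1 := hX w hw
    rw [prod_map_of_similar hRS h, Matrix.mul_smul, Matrix.trace_smul, smul_eq_mul, mul_eq_zero]
      at h1
    rw [← h1.resolve_left (pow_ne_zero _ hμ), mul_assoc, mul_assoc, Matrix.trace_mul_comm]
    simp only [mul_assoc]
  calc X = (R * S) * X * (R * S) := by rw [hRS, one_mul, mul_one]
    _ = R * (S * X * R) * S := by simp only [mul_assoc]
    _ = 0 := by rw [h0, mul_zero, zero_mul]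

lemma Represents.of_similar {ψ : Vec d N} (hA : Represents A ψ) (hRS : R * S = 1)
    (h : ∀ i, B i = μ • (R * A i * S)) (hμ : μ ≠ 0) : Represents B ψ := by
  obtain ⟨c, hc, hψ⟩ := hA
  refine ⟨c * (μ ^ N)⁻¹, mul_ne_zero hc (inv_ne_zero (pow_ne_zero _ hμ)), ?_⟩
  rw [tiVec_of_similar hRS h, smul_smul, mul_assoc, inv_mul_cancel₀ (pow_ne_zero _ hμ), mul_one,
    hψ]

/-- A spanning family is similar, up to a scalar factor, to one with a unital transfer map. -/
theorem SpansAt.exists_similar_unital [NeZero D] (hA : SpansAt A L) (hA0 : ∃ i, A i ≠ 0) :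
    ∃ (R S : Matrix (Fin D) (Fin D) ℂ) (μ : ℂ), R * S = 1 ∧ μ ≠ 0 ∧
      transfer (fun i => μ • (R * A i * S)) 1 = 1 := by
  obtain ⟨r, hr, X, hX, heig⟩ := hA.exists_posDef_eigenvector hA0
  obtain ⟨Y, rfl⟩ := exists_eq_mul_conjTranspose hX.posSemidef
  have hYu : IsUnit Y := by
    have h1 := (Matrix.isUnit_iff_isUnit_det _).1 hX.isUnit
    rw [Matrix.det_mul] at h1
    exact (Matrix.isUnit_iff_isUnit_det _).2 (isUnit_of_mul_isUnit_left h1)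
  have hYu' := (Matrix.isUnit_iff_isUnit_det _).1 hYu
  have hSR : Y * Y⁻¹ = 1 := Matrix.mul_nonsing_inv Y hYu'
  have hRS : Y⁻¹ * Y = 1 := Matrix.nonsing_inv_mul Y hYu'
  -- Conjugation by `Y⁻¹` carries the eigenvector `Y * Yᴴ` to `1`, and the factor `1 / √r`
  -- normalizes its eigenvalue.
  refine ⟨Y⁻¹, Y, (((√r)⁻¹ : ℝ) : ℂ), hRS, ?_, ?_⟩
  · have : (√r)⁻¹ ≠ 0 := by positivity
    exact_mod_cast this
  · have h1 := transfer_conj (A := A) (B := fun i => (((√r)⁻¹ : ℝ) : ℂ) • (Y⁻¹ * A i * Y)) hSR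
      (fun i => rfl) (Y * Yᴴ)
    have h2 : Y⁻¹ * (Y * Yᴴ) * Y⁻¹ᴴ = 1 := by
      rw [← mul_assoc, hRS, one_mul, ← Matrix.conjTranspose_mul, hRS, Matrix.conjTranspose_one]
    have h3 : ‖(((√r)⁻¹ : ℝ) : ℂ)‖ ^ 2 * r = 1 := by
      rw [Complex.norm_real, Real.norm_of_nonneg (by positivity), inv_pow, Real.sq_sqrt hr.le,
        inv_mul_cancel₀ hr.ne']
    rw [heig, Matrix.mul_smul, Matrix.smul_mul, smul_smul, ← Complex.ofReal_mul, h3, h2] at h1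
    simpa using h1

end Similarity

/-! ### Solutions of the quadratic system -/

section Solutions

variable {d D L : ℕ} {A B : Fin d → Matrix (Fin D) (Fin D) ℂ}

lemma eq_zero_of_kronecker_mulVec (hA : ∀ v : Fin D → ℂ, (∀ i, A i *ᵥ v = 0) → v = 0)
    (V : Fin D × Fin D → ℂ)
    (hV : ∀ i, (A i ⊗ₖ (1 : Matrix (Fin D) (Fin D) ℂ)) *ᵥ V = 0) : V = 0 := by
  have h : ∀ b, (fun a => V (a, b)) = 0 := fun b => hA _ fun i => by
    funext a
    have := congrFun (hV i) (a, b)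
    simpa [Matrix.mulVec, dotProduct, Fintype.sum_prod_type, Matrix.one_apply] using this
  funext p
  exact congrFun (h p.2) p.1

lemma eq_zero_of_mulVec_of_kronecker
    (hA : ∀ V : Fin D × Fin D → ℂ,
      (∀ i, (A i ⊗ₖ (1 : Matrix (Fin D) (Fin D) ℂ)) *ᵥ V = 0) → V = 0)
    (v : Fin D → ℂ) (hv : ∀ i, A i *ᵥ v = 0) : v = 0 := by
  have h := hA (fun p => v p.1) fun i => by
    funext p
    have := congrFun (hv i) p.1
    simpa [Matrix.mulVec, dotProduct, Fintype.sum_prod_type, Matrix.one_apply] using this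
  funext a
  exact congrFun h (a, a)

lemma exists_ne_zero_of_unital [NeZero D] (hone : transfer A 1 = 1) : ∃ i, A i ≠ 0 := by
  by_contra! hcon
  have : transfer A 1 = 0 := by simp [transfer_apply, hcon]
  exact one_ne_zero (hone.symm.trans this)

/-- The matrices of a solution of the system have no common kernel. -/
lemma SpansAt.eq_zero_of_mulVec_of_solution [NeZero D] (hA : SpansAt A L)
    (hone : transfer A 1 = 1) (hB : transfer B 1 = 1)
    {y z : Fin (D ^ 4) → Matrix (Fin D × Fin D) (Fin D × Fin D) ℂ}
    (h : ∀ k i, B i ⊗ₖ (1 : Matrix (Fin D) (Fin D) ℂ) =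
      y k * (A i ⊗ₖ (1 : Matrix (Fin D) (Fin D) ℂ)) * z k)
    (hyz : ∀ k l : Fin (D ^ 4), l.val = k.val + 1 → y l * z k = 1)
    {v : Fin D → ℂ} (hv : ∀ i, B i *ᵥ v = 0) : v = 0 := by
  have hD := NeZero.ne D
  -- For `D = 1` the window is a single site and the relations `y z = 1` are void, but a non-zero
  -- scalar `B i` suffices. For `D ≥ 2` there is an interior site, whose `y` and `z` are both
  -- invertible.
  rcases (show D = 1 ∨ 2 ≤ D by omega) with rfl | hD2
  · obtain ⟨i, hi⟩ := exists_ne_zero_of_unital hB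
    funext a
    have h1 := congrFun (hv i) a
    simp only [Matrix.mulVec, dotProduct, Finset.univ_unique, Finset.sum_singleton,
      Pi.zero_apply, mul_eq_zero] at h1
    rw [Subsingleton.elim a default]
    refine h1.resolve_left fun h2 => hi ?_
    ext a' b'
    rw [Subsingleton.elim a' a, Subsingleton.elim b' default]
    exact h2
  · have h4 : 2 < D ^ 4 := lt_of_lt_of_le (by norm_num) (Nat.pow_le_pow_left hD2 4)
    refine eq_zero_of_mulVec_of_kronecker (A := B) (fun V hV => ?_) v hv
    have h10 : z ⟨0, by omega⟩ * y ⟨1, by omega⟩ = 1 :=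
      mul_eq_one_comm.1 (hyz ⟨0, by omega⟩ ⟨1, by omega⟩ rfl)
    have h21 : y ⟨2, by omega⟩ * z ⟨1, by omega⟩ = 1 := hyz ⟨1, by omega⟩ ⟨2, by omega⟩ rfl
    have h3 : z ⟨1, by omega⟩ *ᵥ V = 0 := by
      refine eq_zero_of_kronecker_mulVec
        (fun v => hA.eq_zero_of_mulVec (exists_ne_zero_of_unital hone)) _ fun i => ?_
      have h5 := hV i
      rw [h ⟨1, by omega⟩, mul_assoc, ← Matrix.mulVec_mulVec] at h5
      have h6 := congrArg (fun u => z ⟨0, by omega⟩ *ᵥ u) h5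
      simp only [Matrix.mulVec_mulVec, ← mul_assoc, Matrix.mulVec_zero] at h6
      rwa [h10, one_mul, ← Matrix.mulVec_mulVec] at h6
    rw [← Matrix.one_mulVec V, ← h21, ← Matrix.mulVec_mulVec, h3, Matrix.mulVec_zero]

/-- The matrices of a solution of the system are similar to the given ones. -/
theorem SpansAt.exists_similar_of_solution [NeZero D] (hA : SpansAt A L)
    (hone : transfer A 1 = 1) (hB : transfer B 1 = 1)
    {y z : Fin (D ^ 4) → Matrix (Fin D × Fin D) (Fin D × Fin D) ℂ}
    (h : ∀ k i, B i ⊗ₖ (1 : Matrix (Fin D) (Fin D) ℂ) =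
      y k * (A i ⊗ₖ (1 : Matrix (Fin D) (Fin D) ℂ)) * z k)
    (hyz : ∀ k l : Fin (D ^ 4), l.val = k.val + 1 → y l * z k = 1) :
    ∃ μ : ℂ, μ ≠ 0 ∧ ∃ R S : Matrix (Fin D) (Fin D) ℂ, R * S = 1 ∧
      ∀ i, B i = μ • (R * A i * S) := by
  have hD : 0 < D ^ 4 := pow_pos (NeZero.pos D) 4
  have hker : ∀ v : Fin D → ℂ, (∀ i, B i *ᵥ v = 0) → v = 0 := fun v hv =>
    hA.eq_zero_of_mulVec_of_solution hone hB h hyz hv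
  set e : Fin (D ^ 4) := ⟨D ^ 4 - 1, by omega⟩ with he
  -- No relation `y z = 1` involves the last `z`; its invertibility comes from the absence of a
  -- common kernel of the `B_i ⊗ 1`.
  have hzu : IsUnit (z e) := by
    rw [← Matrix.mulVec_injective_iff_isUnit, ← Matrix.coe_mulVecLin, ← LinearMap.ker_eq_bot,
      LinearMap.ker_eq_bot']
    intro V hV
    rw [Matrix.mulVecLin_apply] at hV
    refine eq_zero_of_kronecker_mulVec hker V fun i => ?_
    rw [h e, ← Matrix.mulVec_mulVec, hV, Matrix.mulVec_zero]
  have hz : z e * (z e)⁻¹ = 1 :=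
    Matrix.mul_nonsing_inv _ ((Matrix.isUnit_iff_isUnit_det _).1 hzu)
  refine hA.exists_similar_of_chain hone hker
    -- The sequence `y_k` is completed at the right end by the inverse of the last `z`, the place
    -- where the next `y` would stand.
    (fun k => if hk : k < D ^ 4 then y ⟨k, hk⟩ else (z e)⁻¹) (fun k hk i => ?_) ?_
  · rw [dif_pos hk, h ⟨k, hk⟩]
    by_cases hk' : k + 1 < D ^ 4
    · rw [dif_pos hk', mul_assoc, mul_eq_one_comm.1 (hyz ⟨k, hk⟩ ⟨k + 1, hk'⟩ rfl), mul_one]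
    · have hke : (⟨k, hk⟩ : Fin (D ^ 4)) = e := Fin.ext (by simp [he]; omega)
      rw [dif_neg hk', hke, mul_assoc, hz, mul_one]
  · rw [dif_neg (lt_irrefl _)]
    intro h0
    rw [h0, mul_zero] at hz
    exact zero_ne_one hz

end Solutions

/-! ### Canonical forms with a single block -/

section TICanonical

variable {d D L : ℕ} {A : Fin d → Matrix (Fin D) (Fin D) ℂ}

/-- A single canonical block is in TI canonical form. -/
lemma IsCanonicalBlock.isTICanonical [NeZero D] (hA : IsCanonicalBlock A) : IsTICanonical A := by
  refine ⟨1, fun _ => D, Equiv.uniqueSigma (fun _ : Fin 1 => Fin D), fun _ => 1, fun _ => A,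
    fun _ => NeZero.pos D, fun _ => ⟨one_pos, le_rfl⟩, ⟨0, rfl⟩, fun i => ?_, fun _ => hA⟩
  ext a b
  rw [Matrix.reindex_apply, Matrix.submatrix_apply]
  change _ = Matrix.blockDiagonal' (fun _ : Fin 1 => ((1 : ℝ) : ℂ) • A i) ⟨default, a⟩ ⟨default, b⟩
  rw [Matrix.blockDiagonal'_apply_eq]
  simp

/-- A TI canonical form with spanning products consists of a single block, so that its transfer map
is unital. -/
lemma IsTICanonical.transfer_one (hA : IsTICanonical A) (hs : SpansAt A L) :
    transfer A 1 = 1 := by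
  obtain ⟨b, n, e, w, C, hn, hw, ⟨j₁, hj₁⟩, hAC, hC⟩ := hA
  have hword : ∀ l : List (Fin d), ∃ M : (j : Fin b) → Matrix (Fin (n j)) (Fin (n j)) ℂ,
      (l.map A).prod = Matrix.reindex e e (Matrix.blockDiagonal' M) := by
    intro l
    induction l with
    | nil =>
      refine ⟨1, ?_⟩
      rw [Matrix.blockDiagonal'_one]
      simp
    | cons i l ih =>
      obtain ⟨M, hM⟩ := ih
      refine ⟨fun j => ((w j : ℂ) • C j i) * M j, ?_⟩
      rw [List.map_cons, List.prod_cons, hM, hAC, Matrix.blockDiagonal'_mul]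
      simp [Matrix.submatrix_mul_equiv]
  -- Words are block diagonal, so a matrix unit joining two different blocks would be
  -- trace-orthogonal to all of them.
  have hsub : ∀ j, j = j₁ := by
    intro j
    by_contra hj
    have h0 := hs (Matrix.single (e ⟨j, ⟨0, hn j⟩⟩) (e ⟨j₁, ⟨0, hn j₁⟩⟩) 1) fun l _ => by
      obtain ⟨M, hM⟩ := hword l
      rw [hM, Matrix.trace_single_mul]
      simp [Matrix.blockDiagonal'_apply_ne _ _ _ (Ne.symm hj)]
    have h1 := congrFun (congrFun h0 (e ⟨j, ⟨0, hn j⟩⟩)) (e ⟨j₁, ⟨0, hn j₁⟩⟩)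
    simp at h1
  have hw1 : ∀ j, w j = 1 := fun j => by rw [hsub j, hj₁]
  have hterm : ∀ i, A i * (A i)ᴴ =
      Matrix.reindex e e (Matrix.blockDiagonal' fun j => C j i * (C j i)ᴴ) := by
    intro i
    rw [hAC, Matrix.conjTranspose_reindex, Matrix.blockDiagonal'_conjTranspose,
      Matrix.blockDiagonal'_mul]
    simp [Matrix.submatrix_mul_equiv, hw1]
  rw [transfer_apply]
  simp only [mul_one, hterm]
  have hsum : ∑ i, Matrix.blockDiagonal' (fun j => C j i * (C j i)ᴴ) =
      Matrix.blockDiagonal' (1 : (j : Fin b) → Matrix (Fin (n j)) (Fin (n j)) ℂ) := by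
    have h1 := map_sum (Matrix.blockDiagonal'AddMonoidHom (fun j => Fin (n j))
      (fun j => Fin (n j)) ℂ) (fun i j => C j i * (C j i)ᴴ) Finset.univ
    rw [show (∑ i, fun j => C j i * (C j i)ᴴ) = 1 by
      funext j
      rw [Finset.sum_apply]
      exact (hC j).1] at h1
    exact h1.symm
  calc ∑ i, Matrix.reindex e e (Matrix.blockDiagonal' fun j => C j i * (C j i)ᴴ)
      = Matrix.reindex e e (∑ i, Matrix.blockDiagonal' fun j => C j i * (C j i)ᴴ) := by
        ext a a'
        simp [Matrix.sum_apply]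
    _ = 1 := by
        rw [hsum, Matrix.blockDiagonal'_one]
        simp

end TICanonical

/-! ### Comparing chains on the window -/

section Window

variable {d N D L₀ : ℕ}

/-- In the middle of the ring, the bonds of an OBC canonical form can be identified with pairs of
bonds of a TI representation. -/
lemma exists_isGauge_toChain {F : OBCForm d N} (hF : F.IsCanonical)
    {A : Fin d → Matrix (Fin D) (Fin D) ℂ} (hA : SpansAt A L₀) (hone : transfer A 1 = 1)
    {c : ℂ} (hc : c ≠ 0) (hval : F.toVec = c • tiVec N A) (s₀ : Fin N → Fin d)
    (m : Fin (N + 1)) (h1 : L₀ ≤ m.val) (h2 : m.val + L₀ ≤ N) :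
    ∃ G G', Chain.IsGauge F.toChain (tiChain N A c) m G G' :=
  Chain.exists_isGauge (by rw [F.toChain_value, tiChain_value, hval]) (hF.leftFull s₀ m)
    (hF.rightFull s₀ m) ((hA.mono hone h1).leftFull s₀ hc)
    ((hA.mono hone (by omega)).rightFull s₀)

/-- At least `L₀` sites lie on either side of each bond of the window, so a gauge identifies the
bond space with `ℂ^D ⊗ ℂ^D`. -/
lemma hasWindow_of_represents (hN : 2 * L₀ + D ^ 4 ≤ N) {F : OBCForm d N} (hF : F.IsCanonical)
    {A : Fin d → Matrix (Fin D) (Fin D) ℂ} (hA : SpansAt A L₀) (hone : transfer A 1 = 1)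
    {c : ℂ} (hc : c ≠ 0) (hval : F.toVec = c • tiVec N A) (s₀ : Fin N → Fin d) :
    F.HasWindow D L₀ := by
  refine ⟨by omega, fun m h1 h2 => ?_⟩
  obtain ⟨G, G', hG⟩ := exists_isGauge_toChain hF hA hone hc hval s₀ m h1 (by omega)
  have h3 := (Matrix.toLin'OfInv hG.mul_eq_one' hG.mul_eq_one).finrank_eq
  rw [Module.finrank_fintype_fun_eq_card, Module.finrank_fintype_fun_eq_card] at h3
  have h4 : Fintype.card (Fin (F.dim m)) = Fintype.card (Fin D × Fin D) := h3.symm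
  simpa [pow_two] using h4

/-- Gauge transformations between the window of the OBC canonical form and a TI representation. -/
lemma exists_window_gauge (hN : 2 * L₀ + D ^ 4 ≤ N) {F : OBCForm d N} (hF : F.IsCanonical)
    {A : Fin d → Matrix (Fin D) (Fin D) ℂ} (hA : SpansAt A L₀) (hone : transfer A 1 = 1)
    {c : ℂ} (hc : c ≠ 0) (hval : F.toVec = c • tiVec N A) (s₀ : Fin N → Fin d)
    (h : F.HasWindow D L₀) :
    ∃ (G : ℕ → Matrix (Fin (D ^ 2)) (Fin D × Fin D) ℂ)
      (G' : ℕ → Matrix (Fin D × Fin D) (Fin (D ^ 2)) ℂ),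
      (∀ k ≤ D ^ 4, G k * G' k = 1 ∧ G' k * G k = 1) ∧
      ∀ (k : Fin (D ^ 4)) (i : Fin d), F.window h k i * G (k + 1) =
        G k * (A i ⊗ₖ (1 : Matrix (Fin D) (Fin D) ℂ)) := by
  have hb : ∀ k ≤ D ^ 4, L₀ + k < N + 1 := fun k hk => by omega
  have hg : ∀ k : ℕ, ∀ hk : k ≤ D ^ 4, ∃ G G',
      Chain.IsGauge F.toChain (tiChain N A c) ⟨L₀ + k, hb k hk⟩ G G' := fun k hk =>
    exists_isGauge_toChain hF hA hone hc hval s₀ ⟨L₀ + k, hb k hk⟩ (Nat.le_add_right _ _)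
      (by simp only; omega)
  choose G G' hG using hg
  have hdim : ∀ k : ℕ, ∀ hk : k ≤ D ^ 4, D ^ 2 = F.dim ⟨L₀ + k, hb k hk⟩ := fun k hk =>
    (h.2 _ (Nat.le_add_right _ _) (Nat.add_le_add_left hk L₀)).symm
  have hbij : ∀ k : ℕ, ∀ hk : k ≤ D ^ 4, Function.Bijective (Fin.cast (hdim k hk)) := fun k hk =>
    (finCongr (hdim k hk)).bijective
  -- The gauge relations are restated over the types `Fin (F.dim _)`, so that the casts to `Fin (D ^
  -- 2)` become plain reindexings.
  obtain ⟨M, H, H', hM, hH, hH', hMH⟩ : ∃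
      (M : ∀ k, ∀ hk : k < D ^ 4, Fin d →
        Matrix (Fin (F.dim ⟨L₀ + k, hb k hk.le⟩)) (Fin (F.dim ⟨L₀ + (k + 1), hb (k + 1) hk⟩)) ℂ)
      (H : ∀ k, ∀ hk : k ≤ D ^ 4, Matrix (Fin (F.dim ⟨L₀ + k, hb k hk⟩)) (Fin D × Fin D) ℂ)
      (H' : ∀ k, ∀ hk : k ≤ D ^ 4, Matrix (Fin D × Fin D) (Fin (F.dim ⟨L₀ + k, hb k hk⟩)) ℂ),
      (∀ k hk i, F.window h ⟨k, hk⟩ i = (M k hk i).submatrix (Fin.cast (hdim k hk.le))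
        (Fin.cast (hdim (k + 1) hk))) ∧
      (∀ k hk, H k hk * H' k hk = 1) ∧ (∀ k hk, H' k hk * H k hk = 1) ∧
      ∀ k hk i, M k hk i * H (k + 1) hk =
        H k hk.le * (A i ⊗ₖ (1 : Matrix (Fin D) (Fin D) ℂ)) :=
    ⟨fun k hk i => F.mat ⟨L₀ + k, by omega⟩ i, G, G', fun k hk i => rfl,
      fun k hk => (hG k hk).mul_eq_one, fun k hk => (hG k hk).mul_eq_one', fun k hk i =>
      Chain.IsGauge.mat_mul (K := F.toChain) (K' := tiChain N A c) (m := ⟨L₀ + k, by omega⟩)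
        (by rw [F.toChain_value, tiChain_value, hval])
        (hF.leftFull s₀ _) ((hA.mono hone (by simp only [Fin.succ_mk]; omega)).rightFull s₀)
        (hG k hk.le) (hG (k + 1) hk) i⟩
  refine ⟨fun k => if hk : k ≤ D ^ 4 then (H k hk).submatrix (Fin.cast (hdim k hk)) id else 0,
    fun k => if hk : k ≤ D ^ 4 then (H' k hk).submatrix id (Fin.cast (hdim k hk)) else 0,
    fun k hk => ⟨?_, ?_⟩, fun k i => ?_⟩
  · simp only [dif_pos hk]
    rw [← Matrix.submatrix_mul _ _ _ _ _ Function.bijective_id, hH]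
    exact Matrix.submatrix_one _ (hbij k hk).1
  · simp only [dif_pos hk]
    rw [← Matrix.submatrix_mul _ _ _ _ _ (hbij k hk), hH', Matrix.submatrix_id_id]
  · have hk : k.val ≤ D ^ 4 := k.2.le
    have hk1 : k.val + 1 ≤ D ^ 4 := k.2
    simp only [dif_pos hk, dif_pos hk1]
    rw [hM k.val k.2 i, ← Matrix.submatrix_mul _ _ _ _ _ (hbij _ hk1), hMH,
      Matrix.submatrix_mul _ _ _ id _ Function.bijective_id, Matrix.submatrix_id_id]

/-- Two TI representations of a state, one with spanning products and a unital transfer map and the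
other one in TI canonical form, are similar up to a scalar factor. -/
lemma IsTICanonical.exists_similar [NeZero D] (hN : 2 * L₀ + D ^ 4 ≤ N)
    {A A' : Fin d → Matrix (Fin D) (Fin D) ℂ} (hA : SpansAt A L₀) (hone : transfer A 1 = 1)
    {c c' : ℂ} (hc : c ≠ 0) (hc' : c' ≠ 0) (hval : c' • tiVec N A' = c • tiVec N A)
    (s₀ : Fin N → Fin d) (hA' : IsTICanonical A') :
    transfer A' 1 = 1 ∧ ∃ μ : ℂ, μ ≠ 0 ∧ ∃ R S : Matrix (Fin D) (Fin D) ℂ, R * S = 1 ∧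
      ∀ i, A' i = μ • (R * A i * S) := by
  have hvalue : (tiChain N A' c').value = (tiChain N A c).value := by
    rw [tiChain_value, tiChain_value, hval]
  -- Both TI chains have bond dimension `D ^ 2`, and that of `A` is minimal at bond `L₀`; so that of
  -- `A'` is left full there, which means that its words of length `L₀` span.
  have hs' : SpansAt A' L₀ :=
    spansAt_of_leftFull (m := ⟨L₀, by omega⟩) (c := c') (Chain.leftFull_of_minimal hvalue.symm
      (hA.leftFull s₀ hc) ((hA.mono hone (by simp only; omega)).rightFull s₀) rfl)
  have hone' := hA'.transfer_one hs'
  refine ⟨hone', ?_⟩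
  have hl : ∀ m : Fin (N + 1), L₀ ≤ m.val → (tiChain N A' c').LeftFull m := fun m hm =>
    (hs'.mono hone' hm).leftFull s₀ hc'
  have hr : ∀ m : Fin (N + 1), m.val + L₀ ≤ N → (tiChain N A c).RightFull m := fun m hm =>
    (hA.mono hone (by omega)).rightFull s₀
  have hb : ∀ k ≤ D ^ 4, L₀ + k < N + 1 := fun k hk => by omega
  have hg : ∀ k : ℕ, ∀ hk : k ≤ D ^ 4, ∃ G G',
      Chain.IsGauge (tiChain N A' c') (tiChain N A c) ⟨L₀ + k, hb k hk⟩ G G' := fun k hk =>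
    Chain.exists_isGauge hvalue (hl _ (Nat.le_add_right _ _))
      ((hs'.mono hone' (show L₀ ≤ N - (L₀ + k) by omega)).rightFull s₀)
      ((hA.mono hone (Nat.le_add_right _ _)).leftFull s₀ hc)
      (hr _ (show L₀ + k + L₀ ≤ N by omega))
  choose G G' hG using hg
  obtain ⟨H, H', hH, hMH⟩ : ∃
      (H H' : ∀ k, k ≤ D ^ 4 → Matrix (Fin D × Fin D) (Fin D × Fin D) ℂ),
      (∀ k hk, H k hk * H' k hk = 1) ∧
      ∀ k, ∀ hk : k < D ^ 4, ∀ i, (A' i ⊗ₖ (1 : Matrix (Fin D) (Fin D) ℂ)) * H (k + 1) hk =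
        H k hk.le * (A i ⊗ₖ (1 : Matrix (Fin D) (Fin D) ℂ)) :=
    ⟨G, G', fun k hk => (hG k hk).mul_eq_one, fun k hk i =>
      Chain.IsGauge.mat_mul (K := tiChain N A' c') (K' := tiChain N A c)
        (m := ⟨L₀ + k, by omega⟩) hvalue (hl _ (Nat.le_add_right _ _))
        (hr _ (by simp only [Fin.succ_mk]; omega)) (hG k hk.le) (hG (k + 1) hk) i⟩
  refine hA.exists_similar_of_chain hone
    (fun v => hs'.eq_zero_of_mulVec (exists_ne_zero_of_unital hone'))
    (fun k => if hk : k ≤ D ^ 4 then H k hk else 0) (fun k hk i => ?_) ?_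
  · rw [dif_pos hk.le, dif_pos (show k + 1 ≤ D ^ 4 from hk), hMH]
  · rw [dif_pos le_rfl]
    intro h0
    have h1 := hH (D ^ 4) le_rfl
    rw [h0, zero_mul] at h1
    exact zero_ne_one h1

end Window

end MPS

/-! ### Assembly of the theorem -/

theorem theorem8 (d N D L₀ : ℕ) (hN : 2 * L₀ + D ^ 4 ≤ N)
    (ψ : MPS.Vec d N) (hψ : MPS.IsNormalized ψ) (hTI : MPS.IsTranslationInvariant ψ)
    (hunique : MPS.HasUniqueOBCCanonicalForm ψ)
    (hrank : MPS.ReducedRanksLE ψ (D ^ 2))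
    (F : MPS.OBCForm d N) (hF : F.IsCanonical) (hFψ : F.toVec = ψ)
    (hC1 : ∃ A : Fin d → Matrix (Fin D) (Fin D) ℂ, MPS.Represents A ψ ∧ MPS.ConditionC1 A L₀) :
    ∃ h : F.HasWindow D L₀,
      (∃ Y Z B, MPS.SolvesS (F.window h) Y Z B) ∧
      ∀ Y Z B, MPS.SolvesS (F.window h) Y Z B →
        MPS.Represents B ψ ∧
        (∃ U ∈ Matrix.unitaryGroup (Fin D) ℂ, MPS.IsTICanonical (fun i => U * B i * Uᴴ)) ∧
        ∀ A : Fin d → Matrix (Fin D) (Fin D) ℂ, MPS.IsTICanonical A → MPS.Represents A ψ →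
          ∃ U ∈ Matrix.unitaryGroup (Fin D) ℂ, ∃ ζ : ℂ, ‖ζ‖ = 1 ∧
            ∀ i, A i = ζ • (U * B i * Uᴴ) := by
  classical
  open MPS in
  obtain ⟨A₀, hA₀, hA₀C1⟩ := hC1
  -- A non-zero coefficient excludes `D = 0` and the zero family, and provides the configuration
  -- `s₀` that fills unused sites.
  obtain ⟨s₀, hs₀⟩ : ∃ s, ψ s ≠ 0 := by
    by_contra! hcon
    simp [IsNormalized, hcon] at hψ
  have htr : (word A₀ s₀).trace ≠ 0 := by
    obtain ⟨c, -, hc⟩ := hA₀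
    intro h0
    apply hs₀
    rw [hc]
    change c * (word A₀ s₀).trace = 0
    rw [h0, mul_zero]
  have hD : D ≠ 0 := by
    rintro rfl
    exact htr (by simp [Matrix.trace])
  have : NeZero D := ⟨hD⟩
  have hN0 : 0 < N := lt_of_lt_of_le (pow_pos (NeZero.pos D) 4) (le_trans (by omega) hN)
  have hne : ∃ i, A₀ i ≠ 0 := by
    by_contra! hcon
    apply htr
    have : NeZero N := ⟨hN0.ne'⟩
    have h0 : (0 : Matrix (Fin D) (Fin D) ℂ) ∈ List.ofFn fun k => A₀ (s₀ k) :=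
      (List.mem_ofFn' _ _).2 ⟨0, hcon _⟩
    rw [word, List.prod_eq_zero h0, Matrix.trace_zero]
  obtain ⟨R₀, S₀, μ₀, hRS₀, hμ₀, hone⟩ := hA₀C1.spansAt.exists_similar_unital hne
  set A : Fin d → Matrix (Fin D) (Fin D) ℂ := fun i => μ₀ • (R₀ * A₀ i * S₀) with hAdef
  have hA : SpansAt A L₀ := hA₀C1.spansAt.of_similar hRS₀ (fun _ => rfl) hμ₀
  have hAψ : Represents A ψ := hA₀.of_similar hRS₀ (fun _ => rfl) hμ₀
  obtain ⟨c, hc, hcψ⟩ := id hAψ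
  have hval : F.toVec = c • tiVec N A := by rw [hFψ, hcψ]
  have hwin := hasWindow_of_represents hN hF hA hone hc hval s₀
  obtain ⟨G, G', hG, hwG⟩ := exists_window_gauge hN hF hA hone hc hval s₀ hwin
  refine ⟨hwin, ⟨fun k => G' k, fun k => G (k + 1), A, fun k i => ?_, fun k l hkl => ?_, ?_⟩, ?_⟩
  · rw [Matrix.mul_assoc, hwG, ← Matrix.mul_assoc, (hG k k.2.le).2, Matrix.one_mul]
  · simp only [hkl]
    exact (hG (k + 1) k.2).2
  · simpa [transfer_apply] using hone
  · rintro Y Z B ⟨hS1, hS2, hS3⟩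
    have hBone : transfer B 1 = 1 := by simpa [transfer_apply] using hS3
    -- Inserting `G G' = 1` on the bonds turns the solution for the OBC window into one for the
    -- matrices `A_i ⊗ 1`.
    obtain ⟨μ, hμ, R, S, hRS, hB⟩ := hA.exists_similar_of_solution hone hBone
      (y := fun k => Y k * G k) (z := fun k => G' (k + 1) * Z k)
      (fun k i => by
        calc B i ⊗ₖ (1 : Matrix (Fin D) (Fin D) ℂ)
            = Y k * (F.window hwin k i * (G (k + 1) * G' (k + 1))) * Z k := by
              rw [hS1 k i, (hG (k + 1) k.2).1, Matrix.mul_one]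
          _ = _ := by
              rw [← Matrix.mul_assoc (F.window hwin k i), hwG]
              simp only [Matrix.mul_assoc])
      (fun k l hkl => by
        simp only [hkl]
        calc Y l * G (k + 1) * (G' (k + 1) * Z k) = Y l * (G (k + 1) * G' (k + 1)) * Z k := by
              simp only [Matrix.mul_assoc]
          _ = 1 := by rw [(hG (k + 1) k.2).1, Matrix.mul_one, hS2 k l hkl])
    have hSR : S * R = 1 := mul_eq_one_comm.1 hRS
    have hBs : SpansAt B L₀ := hA.of_similar hRS hB hμ
    refine ⟨hAψ.of_similar hRS hB hμ, ?_, ?_⟩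
    · obtain ⟨U, hU, hUB⟩ := hBs.exists_unitary_isCanonicalBlock hBone
      exact ⟨U, hU, hUB.isTICanonical⟩
    · rintro A' hA' ⟨c', hc', hcψ'⟩
      obtain ⟨hone', μ', hμ', R', S', hRS', hAA'⟩ :=
        hA'.exists_similar hN hA hone hc hc' (by rw [← hcψ', ← hcψ]) s₀
      -- Both families are similar to `A`; composing the similarities passes directly from `B` to
      -- `A'`.
      refine hBs.exists_unitary_of_similar hBone hone' (R := R' * S) (S := R * S')
        (μ := μ' * μ⁻¹) ?_ (fun i => ?_) (mul_ne_zero hμ' (inv_ne_zero hμ))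
      · calc R' * S * (R * S') = R' * (S * R) * S' := by simp only [mul_assoc]
          _ = 1 := by rw [hSR, mul_one, hRS']
      · rw [hAA', hB]
        simp only [Matrix.mul_smul, Matrix.smul_mul, smul_smul]
        rw [mul_assoc μ', inv_mul_cancel₀ hμ, mul_one]
        congr 1
        calc R' * A i * S' = R' * (S * R) * A i * (S * R) * S' := by rw [hSR, mul_one, mul_one]
          _ = _ := by simp only [mul_assoc]
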